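/- Let $K$ be an infinite field, $S_x=K[x_1,\dots,x_n]$ and $S=K[x_1,\dots,x_n,y_1,\dots,y_m]$, bigraded by $\deg x_i=(1,0)$, $\deg y_j=(0,1)$. Let $d\in\mathbb N$, let $f_1,\dots,f_m\in S_x$ be homogeneous of degree $d$, let $I=(f_1,\dots,f_m)$, and let $J\subset S$ be the (bigraded) kernel of the surjection $S\to R(I)=S_x[It]$, $x_i\mapsto x_i$, $y_j\mapsto f_jt$, onto the Rees algebra of $I$, so that $R(I)=S/J$. For a graded $S_x$-module $M$ let $\operatorname{reg}(M)=\sup\{r\in\mathbb Z:\operatorname{Tor}_i^{S_x}(K,M)_{i+r}\ne0\text{ for some }i\}$ (which is $-\infty$ for $M=0$), and let $\operatorname{reg}_x(R(I))=\sup\{a\in\mathbb Z:\operatorname{Tor}_i^{S}(K,S/J)_{(a+i,b)}\neq0\text{ for some }i,b\}$. Order the monomials of $S$ by: $x^uy^v>x^{u'}y^{v'}$ if $(|u|+|v|,|v|,|u|)>(|u'|+|v'|,|v'|,|u'|)$ lexicographically, or these triples are equal and $x^uy^v>x^{u'}y^{v'}$ in the reverse lexicographic order induced by $y_1>\dots>y_m>x_1>\dots>x_n$.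 The bigeneric initial ideal $\operatorname{bigin}(J)$ is the monomial ideal that equals the initial ideal $\operatorname{in}(gJ)$ for all $g$ in a non-empty Zariski open subset of $GL(n,K)\times GL(m,K)$, where $g=(d_{ij},e_{kl})$ acts on $S$ by $g(x_j)=\sum_i d_{ij}x_i$, $g(y_l)=\sum_k e_{kl}y_k$. For a monomial ideal $B$ let $m_y(B)$ be the maximal $y$-degree of a minimal monomial generator of $B$ (and $0$ if $B=0$). Then: (i) $\operatorname{reg}(I^j)\le jd+\operatorname{reg}_x(R(I))$ for all $j\ge 0$. (ii) If $\operatorname{char}K=0$ and $I\neq0$, then there is an integer constant $c$ with $0\le c\le\operatorname{reg}_x(R(I))$ such that $\operatorname{reg}(I^j)=jd+c$ for all $j\ge m_y(\operatorname{bigin}(J))$. -/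

import Mathlib

open MvPolynomial

/-! ### Graded Koszul homology, graded Betti numbers and regularity

For a commutative ring `R`, an `R`-module `M` and a sequence `r` of elements of `R`, an element
`∑ z(T) e_T` of the Koszul complex `⋀ R^N ⊗ M` is stored as the function `T ↦ z(T)` on the finite
subsets `T` of `{0, …, N-1}`. -/

section Koszul

variable {R M : Type*} [CommRing R] [AddCommGroup M] [Module R M]

/-- The Koszul differential, `∂(z e_T) = ∑_{v ∈ T} (-1)^{#{w ∈ T : w < v}} r_v z e_{T \ v}`. -/
def koszulDiff {N : ℕ} (r : Fin N → R) :
    (Finset (Fin N) → M) →ₗ[R] (Finset (Fin N) → M) :=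
  LinearMap.pi fun T =>
    ∑ v ∈ Tᶜ, ((-1 : R) ^ (T.filter (· < v)).card * r v) • LinearMap.proj (insert v T)

variable {K : Type*} [Field K] [Algebra K R] [Module K M] [IsScalarTower K R M]
  {G : Type*} [AddCommGroup G]

/-- The component of homological degree `i` and internal degree `δ` of the Koszul complex of a
graded module `M` with homogeneous components `𝓜`, where the basis element `e_v` has degree
`e v`. -/
def koszulChains {N : ℕ} (e : Fin N → G) (𝓜 : G → Submodule K M) (i : ℕ) (δ : G) :
    Submodule K (Finset (Fin N) → M) :=
  Submodule.pi Set.univ fun T => if T.card = i then 𝓜 (δ - ∑ v ∈ T, e v) else ⊥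

/-- Koszul cycles of homological degree `i` and internal degree `δ`. -/
def koszulCycles {N : ℕ} (r : Fin N → R) (e : Fin N → G) (𝓜 : G → Submodule K M)
    (i : ℕ) (δ : G) : Submodule K (Finset (Fin N) → M) :=
  koszulChains e 𝓜 i δ ⊓ LinearMap.ker ((koszulDiff (M := M) r).restrictScalars K)

/-- Koszul boundaries of homological degree `i` and internal degree `δ`. -/
def koszulBoundaries {N : ℕ} (r : Fin N → R) (e : Fin N → G) (𝓜 : G → Submodule K M)
    (i : ℕ) (δ : G) : Submodule K (Finset (Fin N) → M) :=
  (koszulChains e 𝓜 (i + 1) δ).map ((koszulDiff (M := M) r).restrictScalars K)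

/-- The `K`-dimension of the component of internal degree `δ` of the `i`-th Koszul homology of
`M` with respect to the homogeneous sequence `r` of degrees `e`. When `R` is a polynomial ring
over `K` and `r` is the sequence of its variables, the Koszul complex of `R` is the graded free
resolution of `K`, so this is `dim_K Tor_i^R(K, M)_δ`, the graded Betti number `β_{i,δ}(M)`. -/
noncomputable def koszulBetti {N : ℕ} (r : Fin N → R) (e : Fin N → G)
    (𝓜 : G → Submodule K M) (i : ℕ) (δ : G) : Cardinal :=
  Module.rank K
    (koszulCycles r e 𝓜 i δ ⧸
      (koszulBoundaries r e 𝓜 i δ).submoduleOf (koszulCycles r e 𝓜 i δ))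

end Koszul

/-- The supremum of a set of integers, in the extended reals (`⊥` for the empty set). -/
noncomputable def supInt (A : Set ℤ) : EReal := sSup ((fun a : ℤ => ((a : ℝ) : EReal)) '' A)

section Graded

variable {K : Type*} [Field K] {n : ℕ}

/-- The homogeneous component of degree `l` of an ideal of `K[x_1, …, x_n]`. -/
noncomputable def idealPart (I : Ideal (MvPolynomial (Fin n) K)) (l : ℤ) : Submodule K I :=
  (weightedHomogeneousSubmodule K (fun _ : Fin n => (1 : ℤ)) l).comap
    ((Submodule.subtype I).restrictScalars K)

/-- The Castelnuovo-Mumford regularity over `K[x_1, …, x_n]` of a graded ideal, viewed as a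
graded module: `sup {r : β_{i,i+r} ≠ 0 for some i}`. -/
noncomputable def regIdeal (I : Ideal (MvPolynomial (Fin n) K)) : EReal :=
  supInt {r : ℤ | ∃ i : ℕ,
    koszulBetti (fun v : Fin n => (X v : MvPolynomial (Fin n) K)) (fun _ => (1 : ℤ))
      (idealPart I) i (i + r) ≠ 0}

end Graded

section Bigraded

variable (K : Type*) [Field K] (n m : ℕ)

/-- The bigraded polynomial ring `S = K[x_1, …, x_n, y_1, …, y_m]`; `Sum.inl i` is the index of an
`x`-variable, `Sum.inr j` that of a `y`-variable. -/
abbrev BiPoly : Type _ := MvPolynomial (Fin n ⊕ Fin m) K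

/-- The bidegrees of the variables: `(1, 0)` for the `x_i`, `(0, 1)` for the `y_j`. -/
def biWeight : Fin n ⊕ Fin m → ℤ × ℤ := Sum.elim (fun _ => (1, 0)) (fun _ => (0, 1))

variable {K n m}

/-- The component of bidegree `δ` of `S/J`, for a bigraded ideal `J`. -/
noncomputable def quotPart (J : Ideal (BiPoly K n m)) (δ : ℤ × ℤ) :
    Submodule K (BiPoly K n m ⧸ J) :=
  (weightedHomogeneousSubmodule K (biWeight n m) δ).map (Ideal.Quotient.mkₐ K J).toLinearMap

/-- The bigraded Betti number `β_{i,δ}^S(S/J)`, with the sequence `x_1, …, x_n, y_1, …, y_m`. -/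
noncomputable def biBetti (J : Ideal (BiPoly K n m)) (i : ℕ) (δ : ℤ × ℤ) : Cardinal :=
  koszulBetti
    (Fin.append (fun i : Fin n => (X (Sum.inl i) : BiPoly K n m)) (fun j : Fin m => X (Sum.inr j)))
    (Fin.append (fun _ : Fin n => ((1, 0) : ℤ × ℤ)) (fun _ : Fin m => (0, 1)))
    (quotPart J) i δ

/-- The `x`-regularity of `S/J`: `sup {a : β_{i,(a+i,b)}(S/J) ≠ 0 for some i, b}`. -/
noncomputable def regX (J : Ideal (BiPoly K n m)) : EReal :=
  supInt {a : ℤ | ∃ (i : ℕ) (b : ℤ), biBetti J i (a + i, b) ≠ 0}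

/-! ### The Rees algebra -/

/-- The presentation `S → R(I) = S_x[It]`, `x_i ↦ x_i`, `y_j ↦ f_j t`, of the Rees algebra of
`I = (f_1, …, f_m) ⊆ S_x = K[x_1, …, x_n]`. -/
noncomputable def reesMap (f : Fin m → MvPolynomial (Fin n) K) :
    BiPoly K n m →ₐ[K] reesAlgebra (Ideal.span (Set.range f)) :=
  aeval (Sum.elim (fun i => algebraMap (MvPolynomial (Fin n) K) _ (X i))
    (fun j => ⟨Polynomial.monomial 1 (f j), reesAlgebra.monomial_mem.2
      (by rw [pow_one]; exact Ideal.subset_span (Set.mem_range_self j))⟩))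

/-- The ideal `J` with `R(I) = S/J`. -/
noncomputable def reesIdeal (f : Fin m → MvPolynomial (Fin n) K) : Ideal (BiPoly K n m) :=
  RingHom.ker (reesMap f)

/-! ### The term order and initial ideals -/

/-- `|u|` for the monomial `x^u y^v`. -/
def xDeg (s : Fin n ⊕ Fin m →₀ ℕ) : ℕ := ∑ i, s (Sum.inl i)

/-- `|v|` for the monomial `x^u y^v`. -/
def yDeg (s : Fin n ⊕ Fin m →₀ ℕ) : ℕ := ∑ j, s (Sum.inr j)

/-- Monomials `x^u y^v` are compared through this key: first `(|u|+|v|, |v|, |u|)`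
lexicographically, then reverse lexicographically with `y_1 > ⋯ > y_m > x_1 > ⋯ > x_n`, that is, in
the list of exponents of `x_n, …, x_1, y_m, …, y_1` the first difference decides, and the smaller
exponent belongs to the larger monomial. -/
def termKey (s : Fin n ⊕ Fin m →₀ ℕ) : ℕ ×ₗ (ℕ ×ₗ (ℕ ×ₗ Lex (Fin (n + m) → ℕᵒᵈ))) :=
  toLex (xDeg s + yDeg s, toLex (yDeg s, toLex (xDeg s, toLex (Fin.append
    (fun i : Fin n => OrderDual.toDual (s (Sum.inl i.rev)))
    (fun j : Fin m => OrderDual.toDual (s (Sum.inr j.rev)))))))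

/-- `s` is the exponent of the initial monomial of the polynomial `f`. -/
def IsInitial (f : BiPoly K n m) (s : Fin n ⊕ Fin m →₀ ℕ) : Prop :=
  s ∈ f.support ∧ ∀ t ∈ f.support, t ≠ s → termKey t < termKey s

/-- The initial ideal of `J`. -/
noncomputable def initialIdeal (J : Ideal (BiPoly K n m)) : Ideal (BiPoly K n m) :=
  Ideal.span {z | ∃ f ∈ J, ∃ s, IsInitial f s ∧ z = monomial s 1}

/-! ### The bigeneric initial ideal -/

/-- The action of `g = (d, e) ∈ GL(n, K) × GL(m, K)` on `S`: `g(x_j) = ∑_i d_{ij} x_i` and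
`g(y_l) = ∑_k e_{kl} y_k`. -/
noncomputable def biAct (g : GL (Fin n) K × GL (Fin m) K) : BiPoly K n m →ₐ[K] BiPoly K n m :=
  aeval (Sum.elim (fun j => ∑ i, C (g.1.1 i j) * X (Sum.inl i))
    (fun l => ∑ k, C (g.2.1 k l) * X (Sum.inr k)))

/-- The matrix entries of an element of `GL(n, K) × GL(m, K)`. -/
def biCoords (g : GL (Fin n) K × GL (Fin m) K) : (Fin n × Fin n) ⊕ (Fin m × Fin m) → K :=
  Sum.elim (fun p => g.1.1 p.1 p.2) (fun p => g.2.1 p.1 p.2)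

/-- Zariski open subsets of `GL(n, K) × GL(m, K)`: complements of the common zero set of a family
of polynomials in the matrix entries. -/
def IsZariskiOpen (U : Set (GL (Fin n) K × GL (Fin m) K)) : Prop :=
  ∃ E : Set (MvPolynomial ((Fin n × Fin n) ⊕ (Fin m × Fin m)) K),
    U = {g | ∃ p ∈ E, eval (biCoords g) p ≠ 0}

/-- `B` is the initial ideal of `gJ` for all `g` in some non-empty Zariski open set. -/
def IsBigin (J B : Ideal (BiPoly K n m)) : Prop :=
  ∃ U : Set (GL (Fin n) K × GL (Fin m) K), U.Nonempty ∧ IsZariskiOpen U ∧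
    ∀ g ∈ U, initialIdeal (J.map (biAct g)) = B

open Classical in
/-- The bigeneric initial ideal of a bigraded ideal `J`. Over an infinite field there is exactly
one ideal with the property `IsBigin J`. -/
noncomputable def bigin (J : Ideal (BiPoly K n m)) : Ideal (BiPoly K n m) :=
  if h : ∃ B, IsBigin J B then h.choose else ⊥

/-- The exponents of the minimal monomial generators of a monomial ideal. -/
def minGens (B : Ideal (BiPoly K n m)) : Set (Fin n ⊕ Fin m →₀ ℕ) :=
  {s | monomial s (1 : K) ∈ B ∧ ∀ t ≤ s, monomial t (1 : K) ∈ B → t = s}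

/-- `m_y(B)`, the maximal `y`-degree of a minimal generator of the monomial ideal `B`
(`0` for the zero ideal). -/
noncomputable def mY (B : Ideal (BiPoly K n m)) : ℕ := sSup (yDeg '' minGens B)

end Bigraded

/-! In y-degree j the Rees algebra R(I) = S/J is the ideal I^j with its degrees shifted by jd. So
the Betti numbers of I^j are read off the Koszul complex of x_1, …, x_n on the y-degree-j part of
S/J (`forall_koszulBetti_pow_eq_zero_iff`). A strand collects the chains with a fixed value a of
x-degree minus homological degree, and reg(I^j) - jd is the supremum of the a whose strand is not
exact.

For (i): if Tor^S vanishes along strand a, the Koszul complex of all variables is exact there. The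
y-variables are then discarded one at a time through the long exact sequence, by induction on the
y-degree, starting in negative y-degrees, where everything is zero (`koszulExactOn_compl_map`).

For (ii): choose g with in(gJ) = bigin(J) and put l_v = g⁻¹(x_v). For r ≥ 0 all strands a > r on S/J
are exact in y-degree j if and only if every l_k is injective in x-degrees > r on S/(J, l_{k+1}, …,
l_n); this iterates `forall_strandExactMod_iff`. Since the order is reverse lexicographic inside
each bidegree, with x_n smallest, injectivity means that bigin(J) has no gap: no monomial w outside
it, free of variables after x_k, with w x_k inside it (`regularAt_tailIdeal_iff`). In characteristic
0 the monomials of bigin(J) are strongly stable in x and in y (`exchange_mem_leadSet_map_genAct`),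
so the gaps in y-degree j ≥ m_y do not depend on j (`hasGap_iff`). Hence the last non-exact strand c
is the same for all these j. It is non-negative because y_l^j with f_l ≠ 0 gives a nonzero class in
strand 0, and (i) at j = m_y gives c ≤ reg_x. -/

/-! ### Koszul complexes and their strands. -/

section KoszulStrands

variable {R M : Type*} [CommRing R] [AddCommGroup M] [Module R M] {N : ℕ}

theorem koszulDiff_apply (r : Fin N → R) (z : Finset (Fin N) → M) (T : Finset (Fin N)) :
    koszulDiff r z T =
      ∑ v ∈ Tᶜ, ((-1 : R) ^ (T.filter (· < v)).card * r v) • z (insert v T) := by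
  simp [koszulDiff, LinearMap.sum_apply]

/-- Exterior multiplication by `e_v` on the left. -/
def koszulWedge (v : Fin N) : (Finset (Fin N) → M) →ₗ[R] (Finset (Fin N) → M) :=
  LinearMap.pi fun T =>
    if v ∈ T then ((-1 : R) ^ (T.filter (· < v)).card) • LinearMap.proj (T.erase v) else 0

theorem koszulWedge_apply_of_mem {v : Fin N} {T : Finset (Fin N)} (hv : v ∈ T)
    (z : Finset (Fin N) → M) :
    koszulWedge (R := R) v z T = ((-1 : R) ^ (T.filter (· < v)).card) • z (T.erase v) := by
  simp [koszulWedge, hv]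

theorem koszulWedge_apply_of_notMem {v : Fin N} {T : Finset (Fin N)} (hv : v ∉ T)
    (z : Finset (Fin N) → M) : koszulWedge (R := R) v z T = 0 := by
  simp [koszulWedge, hv]

theorem neg_one_pow_mul_self (k : ℕ) : (-1 : R) ^ k * (-1) ^ k = 1 := by
  rw [← mul_pow]; simp

/-- The homotopy formula: `e_v ∧ ·` is a homotopy between `0` and multiplication by `r_v`. -/
theorem koszulDiff_wedge_add (r : Fin N → R) (v : Fin N) (z : Finset (Fin N) → M) :
    koszulDiff r (koszulWedge (R := R) v z) + koszulWedge (R := R) v (koszulDiff r z) =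
      r v • z := by
  funext T
  rw [Pi.add_apply, Pi.smul_apply, koszulDiff_apply]
  by_cases hv : v ∈ T
  · rw [koszulWedge_apply_of_mem hv, koszulDiff_apply, Finset.smul_sum]
    have hc : (T.erase v)ᶜ = insert v Tᶜ := by
      ext u; by_cases h : u = v <;> simp [h]
    rw [hc, Finset.sum_insert (by simpa using hv), Finset.insert_erase hv]
    have h1 : ((T.erase v).filter (· < v)) = T.filter (· < v) := by
      ext u; simp only [Finset.mem_filter, Finset.mem_erase]
      exact ⟨fun h => ⟨h.1.2, h.2⟩, fun h => ⟨⟨h.2.ne, h.1⟩, h.2⟩⟩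
    rw [h1, smul_smul, ← mul_assoc, neg_one_pow_mul_self, one_mul, add_comm, add_assoc,
      ← Finset.sum_add_distrib]
    rw [Finset.sum_eq_zero, add_zero]
    -- The two terms indexed by `u` have opposite signs: the smaller of `u`, `v` enters exactly one
    -- of the two exponents attached to the larger.
    intro u hu
    have huT : u ∉ T := by simpa using hu
    have huv : u ≠ v := fun h => huT (h ▸ hv)
    rw [koszulWedge_apply_of_mem (Finset.mem_insert_of_mem hv),
      Finset.erase_insert_of_ne huv, smul_smul, smul_smul, ← add_smul]
    convert zero_smul R _
    rcases lt_or_gt_of_ne huv with h | h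
    · have a1 : ((T.erase v).filter (· < u)) = T.filter (· < u) := by
        ext w; simp only [Finset.mem_filter, Finset.mem_erase]
        exact ⟨fun h => ⟨h.1.2, h.2⟩, fun h' => ⟨⟨(h'.2.trans h).ne, h'.1⟩, h'.2⟩⟩
      have a2 : ((insert u T).filter (· < v)).card = (T.filter (· < v)).card + 1 := by
        rw [Finset.filter_insert, if_pos h, Finset.card_insert_of_notMem (by simp [huT])]
      rw [a1, a2]; ring
    · have a1 : (T.filter (· < u)).card = ((T.erase v).filter (· < u)).card + 1 := by
        rw [← Finset.card_insert_of_notMem (a := v) (s := (T.erase v).filter (· < u)) (by simp)]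
        congr 1
        ext w; by_cases hw : w = v <;> simp [hw, hv, h]
      have a2 : ((insert u T).filter (· < v)) = (T.filter (· < v)) := by
        rw [Finset.filter_insert, if_neg h.not_gt]
      rw [a1, a2]; ring
  · rw [koszulWedge_apply_of_notMem hv, add_zero, Finset.sum_eq_single v]
    · rw [koszulWedge_apply_of_mem (Finset.mem_insert_self _ _), Finset.erase_insert hv,
        Finset.filter_insert, if_neg (lt_irrefl v), smul_smul, mul_right_comm,
        neg_one_pow_mul_self, one_mul]
    · intro u _ huv
      rw [koszulWedge_apply_of_notMem (by simp [hv, huv.symm]), smul_zero]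
    · intro h; simp [hv] at h

theorem koszulDiff_wedge (r : Fin N → R) (v : Fin N) (z : Finset (Fin N) → M) :
    koszulDiff r (koszulWedge (R := R) v z) =
      r v • z - koszulWedge (R := R) v (koszulDiff r z) :=
  eq_sub_of_add_eq (koszulDiff_wedge_add r v z)

/-- Up to sign `e_{T ∪ v}` is `e_v ∧ e_T`, and two uses of the homotopy formula give `∂∂(e_v ∧ s) =
r_v ∂s - r_v ∂s + e_v ∧ ∂∂s`. -/
theorem koszulDiff_single_comp (r : Fin N → R) (T : Finset (Fin N)) (x : M) :
    koszulDiff r (koszulDiff r (Pi.single T x)) = 0 := by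
  induction T using Finset.induction_on generalizing x with
  | empty =>
    have : koszulDiff r (Pi.single (∅ : Finset (Fin N)) x) = 0 := by
      funext T
      rw [koszulDiff_apply]
      refine Finset.sum_eq_zero fun v _ => ?_
      rw [Pi.single_eq_of_ne (Finset.insert_ne_empty v T), smul_zero]
    rw [this, map_zero]
  | insert v T hv ih =>
    have : (Pi.single (insert v T) x : Finset (Fin N) → M) =
        koszulWedge (R := R) v (Pi.single T (((-1 : R) ^ (T.filter (· < v)).card) • x)) := by
      funext U
      by_cases hU : U = insert v T
      · subst hU
        rw [Pi.single_eq_same, koszulWedge_apply_of_mem (Finset.mem_insert_self _ _),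
          Finset.erase_insert hv, Pi.single_eq_same, Finset.filter_insert,
          if_neg (lt_irrefl v), smul_smul, neg_one_pow_mul_self, one_smul]
      · rw [Pi.single_eq_of_ne hU]
        by_cases hvU : v ∈ U
        · rw [koszulWedge_apply_of_mem hvU, Pi.single_eq_of_ne, smul_zero]
          rintro rfl
          exact hU (Finset.insert_erase hvU).symm
        · rw [koszulWedge_apply_of_notMem hvU]
    rw [this, koszulDiff_wedge, map_sub, koszulDiff_wedge, ih, map_zero, map_smul]
    simp

/-- The Koszul differential squares to zero. -/
theorem koszulDiff_koszulDiff (r : Fin N → R) (z : Finset (Fin N) → M) :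
    koszulDiff r (koszulDiff r z) = 0 := by
  rw [← Finset.univ_sum_single z, map_sum, map_sum]
  exact Finset.sum_eq_zero fun T _ => koszulDiff_single_comp r T _

variable {K : Type*} [Field K] [Algebra K R] [Module K M] [IsScalarTower K R M]
  {G : Type*} [AddCommGroup G]

/-- Every Koszul cycle with components in `𝓐` is the boundary of a chain with components in
`𝓑`. -/
def KoszulExact (r : Fin N → R) (𝓐 𝓑 : Finset (Fin N) → Submodule K M) : Prop :=
  ∀ z : Finset (Fin N) → M, (∀ T, z T ∈ 𝓐 T) → koszulDiff r z = 0 →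
    ∃ w : Finset (Fin N) → M, (∀ T, w T ∈ 𝓑 T) ∧ koszulDiff r w = z

theorem mem_koszulChains {e : Fin N → G} {𝓜 : G → Submodule K M} {i : ℕ} {δ : G}
    {z : Finset (Fin N) → M} :
    z ∈ koszulChains e 𝓜 i δ ↔
      ∀ T, (T.card = i → z T ∈ 𝓜 (δ - ∑ v ∈ T, e v)) ∧ (T.card ≠ i → z T = 0) := by
  simp only [koszulChains, Submodule.mem_pi, Set.mem_univ, true_implies]
  refine forall_congr' fun T => ?_
  by_cases h : T.card = i <;> simp [h]

theorem koszulBetti_eq_zero_iff {r : Fin N → R} {e : Fin N → G} {𝓜 : G → Submodule K M}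
    {i : ℕ} {δ : G} :
    koszulBetti r e 𝓜 i δ = 0 ↔ ∀ z ∈ koszulChains e 𝓜 i δ, koszulDiff r z = 0 →
      ∃ w ∈ koszulChains e 𝓜 (i + 1) δ, koszulDiff r w = z := by
  rw [koszulBetti, rank_zero_iff, Submodule.Quotient.subsingleton_iff,
    Submodule.submoduleOf_eq_top]
  constructor
  · intro h z hz hz0
    exact Submodule.mem_map.1 (h (Submodule.mem_inf.2 ⟨hz, by simpa using hz0⟩))
  · intro h z hz
    obtain ⟨hz, hz0⟩ := Submodule.mem_inf.1 hz
    exact Submodule.mem_map.2 (h z hz (by simpa using hz0))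

/-- Vanishing of all Koszul homology along the strand `i ↦ (i, α + i u)`, in terms of chains
that are not necessarily homogeneous in the homological degree. -/
theorem forall_koszulBetti_eq_zero_iff {r : Fin N → R} {e : Fin N → G}
    {𝓜 : G → Submodule K M} (u α : G) :
    (∀ i : ℕ, koszulBetti r e 𝓜 i (α + i • u) = 0) ↔
      KoszulExact r (fun T => 𝓜 (α + T.card • u - ∑ v ∈ T, e v))
        (fun T => 𝓜 (α - u + T.card • u - ∑ v ∈ T, e v)) := by
  simp only [koszulBetti_eq_zero_iff, mem_koszulChains]
  constructor
  · intro h z hz hz0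
    -- Since `∂` lowers the cardinality by one, each homological degree of `z` is a cycle by itself
    -- and can be bounded separately.
    have key : ∀ i : ℕ, ∃ w : Finset (Fin N) → M, (∀ T : Finset (Fin N),
        (T.card = i + 1 → w T ∈ 𝓜 (α + i • u - ∑ v ∈ T, e v)) ∧ (T.card ≠ i + 1 → w T = 0)) ∧
        koszulDiff r w = fun T => if T.card = i then z T else 0 := by
      intro i
      refine h i _ (fun T => ⟨fun hT => ?_, fun hT => by simp [hT]⟩) ?_
      · simp only [hT, if_true]; rw [← hT]; exact hz T
      · funext T
        rw [koszulDiff_apply]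
        by_cases hT : T.card + 1 = i
        · have := congrFun hz0 T
          rw [koszulDiff_apply] at this
          rw [Pi.zero_apply] at this ⊢
          rw [← this]
          refine Finset.sum_congr rfl fun v hv => ?_
          rw [Finset.card_insert_of_notMem (by simpa using hv), if_pos hT]
        · refine Finset.sum_eq_zero fun v hv => ?_
          rw [Finset.card_insert_of_notMem (by simpa using hv), if_neg hT, smul_zero]
    choose w hw hw' using key
    -- The component at `T` bounds the part of homological degree `|T| - 1`, whose internal degree
    -- is `α + (|T| - 1) u`; this is the source of `α - u` in the boundary side. Nothing is needed
    -- at `∅`.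
    refine ⟨fun T => if T.card = 0 then 0 else w (T.card - 1) T, fun T => ?_, ?_⟩
    · by_cases hT : T.card = 0
      · simp [hT]
      · obtain ⟨i, hi⟩ := Nat.exists_eq_succ_of_ne_zero hT
        simp only [hT, if_false]
        have := (hw (T.card - 1) T).1 (by omega)
        convert this using 2
        rw [hi, Nat.succ_sub_one, Nat.succ_eq_add_one, add_smul, one_smul]; abel
    · funext T
      rw [koszulDiff_apply]
      have := congrFun (hw' T.card) T
      rw [koszulDiff_apply, if_pos rfl] at this
      rw [← this]
      refine Finset.sum_congr rfl fun v hv => ?_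
      rw [Finset.card_insert_of_notMem (by simpa using hv)]
      simp
  · intro h i z hz hz0
    obtain ⟨w, hw, hw'⟩ := h z (fun T => by
      by_cases hT : T.card = i
      · simpa [hT] using (hz T).1 hT
      · simp [(hz T).2 hT]) hz0
    refine ⟨fun T => if T.card = i + 1 then w T else 0, fun T => ⟨fun hT => ?_, fun hT => ?_⟩, ?_⟩
    · simp only [hT, if_true]
      convert hw T using 2
      rw [hT, add_smul, one_smul]; abel
    · simp [hT]
    · funext T
      rw [koszulDiff_apply]
      by_cases hT : T.card = i
      · rw [← hw', koszulDiff_apply]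
        refine Finset.sum_congr rfl fun v hv => ?_
        rw [Finset.card_insert_of_notMem (by simpa using hv), if_pos (by omega)]
      · rw [(hz T).2 hT]
        refine Finset.sum_eq_zero fun v hv => ?_
        rw [Finset.card_insert_of_notMem (by simpa using hv), if_neg (by omega), smul_zero]

end KoszulStrands

/-! ### Removing elements from a Koszul complex. -/

section KoszulRestrict

variable {R M : Type*} [CommRing R] [AddCommGroup M] [Module R M] {N : ℕ}
  {K : Type*} [Field K] [Module K M]
  {G : Type*} [AddCommGroup G]

theorem neg_one_pow_smul_mem {V : Submodule K M} {x : M} (k : ℕ) :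
    ((-1 : R) ^ k) • x ∈ V ↔ x ∈ V := by
  rcases neg_one_pow_eq_or R k with h | h <;> simp [h]

/-- Exactness of the strand `α` of the Koszul complex of the subsequence `(r_v)_{v ∈ A}`. -/
def KoszulExactOn (r : Fin N → R) (e : Fin N → G) (𝓜 : G → Submodule K M) (u : G)
    (A : Finset (Fin N)) (α : G) : Prop :=
  KoszulExact r (fun T => if T ⊆ A then 𝓜 (α + T.card • u - ∑ v ∈ T, e v) else ⊥)
    (fun T => if T ⊆ A then 𝓜 (α - u + T.card • u - ∑ v ∈ T, e v) else ⊥)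

theorem mem_ite_bot {p : Prop} [Decidable p] {V : Submodule K M} {x : M} :
    x ∈ (if p then V else ⊥) ↔ (p → x ∈ V) ∧ (¬ p → x = 0) := by
  by_cases h : p <;> simp [h]

theorem koszulDiff_apply_eq_zero {r : Fin N → R} {z : Finset (Fin N) → M} {T : Finset (Fin N)}
    (h : ∀ v ∉ T, z (insert v T) = 0) : koszulDiff r z T = 0 := by
  rw [koszulDiff_apply]
  exact Finset.sum_eq_zero fun v hv => by rw [h v (by simpa using hv), smul_zero]

/-- The element `r_v` may be removed from a Koszul complex with an exact strand, provided the
strand shifted by the degree of `r_v` stays exact. -/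
theorem KoszulExactOn.of_insert {r : Fin N → R} {e : Fin N → G} {𝓜 : G → Submodule K M} {u : G}
    {A : Finset (Fin N)} {v : Fin N} (hv : v ∉ A) {α : G}
    (hr : ∀ δ, ∀ x ∈ 𝓜 δ, r v • x ∈ 𝓜 (δ + e v))
    (h : KoszulExactOn r e 𝓜 u (insert v A) α) (h' : KoszulExactOn r e 𝓜 u A (α - e v)) :
    KoszulExactOn r e 𝓜 u A α := by
  intro z hz hz0
  simp only [mem_ite_bot] at hz
  obtain ⟨w, hw, hwz⟩ := h z (fun T => by
    rw [mem_ite_bot]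
    refine ⟨fun _ => ?_, fun hT => (hz T).2 fun h => hT (h.trans (Finset.subset_insert _ _))⟩
    by_cases hTA : T ⊆ A
    · exact (hz T).1 hTA
    · rw [(hz T).2 hTA]; exact zero_mem _) hz0
  simp only [mem_ite_bot] at hw
  have hvT : ∀ {T}, T ⊆ A → v ∉ T := fun hT hvT => hv (hT hvT)
  -- The long exact sequence by hand: with `w = w₀ + e_v ∧ w₁`, both parts free of `e_v`, one gets
  -- `z = ∂w₀ + r_v w₁ - e_v ∧ ∂w₁`. As `z` is free of `e_v`, `∂w₁ = 0`; then `w₁ = ∂y` by `h'`, and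
  -- `z = ∂(w₀ + r_v y)`.
  set w₀ : Finset (Fin N) → M := fun T => if v ∈ T then 0 else w T with hw₀
  set w₁ : Finset (Fin N) → M := fun T =>
    if v ∈ T then 0 else ((-1 : R) ^ (T.filter (· < v)).card) • w (insert v T) with hw₁
  have hdec : w = w₀ + koszulWedge (R := R) v w₁ := by
    funext T
    by_cases hT : v ∈ T
    · rw [Pi.add_apply, koszulWedge_apply_of_mem hT]
      simp only [hw₀, hw₁, hT, if_true, Finset.notMem_erase, if_false, Finset.insert_erase hT,
        zero_add, smul_smul]
      have h1 : ((T.erase v).filter (· < v)) = T.filter (· < v) := by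
        ext u; simp only [Finset.mem_filter, Finset.mem_erase]
        exact ⟨fun h => ⟨h.1.2, h.2⟩, fun h => ⟨⟨h.2.ne, h.1⟩, h.2⟩⟩
      rw [h1, neg_one_pow_mul_self, one_smul]
    · rw [Pi.add_apply, koszulWedge_apply_of_notMem hT]
      simp [hw₀, hT]
  have hz' : z = koszulDiff r w₀ + r v • w₁ - koszulWedge (R := R) v (koszulDiff r w₁) := by
    rw [← hwz, hdec, map_add, koszulDiff_wedge]; abel
  have off₀ : ∀ T, v ∈ T → koszulDiff r w₀ T = 0 := fun T hT =>
    koszulDiff_apply_eq_zero fun a _ => by simp [hw₀, hT]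
  have off₁ : ∀ T, v ∈ T → koszulDiff r w₁ T = 0 := fun T hT =>
    koszulDiff_apply_eq_zero fun a _ => by simp [hw₁, hT]
  have hcyc : koszulDiff r w₁ = 0 := by
    funext T
    by_cases hT : v ∈ T
    · exact off₁ T hT
    · have := congrFun hz' (insert v T)
      rw [(hz _).2 fun h => hvT h (Finset.mem_insert_self _ _), Pi.sub_apply, Pi.add_apply,
        off₀ _ (Finset.mem_insert_self _ _), Pi.smul_apply,
        koszulWedge_apply_of_mem (Finset.mem_insert_self _ _), Finset.erase_insert hT] at this
      have hw₁v : w₁ (insert v T) = 0 := by simp [hw₁]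
      rw [hw₁v, smul_zero, zero_add, zero_sub] at this
      have h2 := neg_eq_zero.1 this.symm
      have h3 := congrArg (fun x => ((-1 : R) ^ ((insert v T).filter (· < v)).card) • x) h2
      simpa only [smul_smul, neg_one_pow_mul_self, one_smul, smul_zero, Pi.zero_apply] using h3
  -- Passing from `insert v T` to `T` gains one `u` and loses `e v`, so `w₁` lies on the cycle side
  -- of strand `α - e v`.
  obtain ⟨y, hy, hyw⟩ := h' w₁ (fun T => by
    rw [mem_ite_bot]
    constructor
    · intro hT
      simp only [hw₁, hvT hT, if_false]
      rw [neg_one_pow_smul_mem]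
      have := (hw (insert v T)).1 (Finset.insert_subset_insert _ hT)
      convert this using 2
      rw [Finset.card_insert_of_notMem (hvT hT), Finset.sum_insert (hvT hT), add_smul, one_smul]
      abel
    · intro hT
      by_cases hT' : v ∈ T
      · simp [hw₁, hT']
      · simp only [hw₁, hT', if_false]
        rw [(hw (insert v T)).2, smul_zero]
        intro h
        refine hT fun a ha => ?_
        have := h (Finset.mem_insert_of_mem ha)
        rw [Finset.mem_insert] at this
        rcases this with rfl | h
        · exact absurd ha hT'
        · exact h) hcyc
  simp only [mem_ite_bot] at hy
  refine ⟨w₀ + r v • y, fun T => ?_, ?_⟩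
  · rw [mem_ite_bot]
    constructor
    · intro hT
      refine add_mem ?_ ?_
      · simp only [hw₀, hvT hT, if_false]
        exact (hw T).1 (hT.trans (Finset.subset_insert _ _))
      · have := hr _ _ ((hy T).1 hT)
        rw [Pi.smul_apply]
        convert this using 2
        abel
    · intro hT
      rw [Pi.add_apply, Pi.smul_apply, (hy T).2 hT, smul_zero, add_zero]
      by_cases hT' : v ∈ T
      · simp [hw₀, hT']
      · simp only [hw₀, hT', if_false]
        refine (hw T).2 fun h => hT fun a ha => ?_
        rcases Finset.mem_insert.1 (h ha) with rfl | h
        · exact absurd ha hT'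
        · exact h
  · rw [map_add, map_smul, hyw, hz', hcyc, map_zero, sub_zero]

theorem koszulDiff_append_map {n m : ℕ} (r : Fin (n + m) → R) {z : Finset (Fin (n + m)) → M}
    (hz : ∀ U, ¬ U ⊆ Finset.univ.map (Fin.castAddEmb m) → z U = 0) (T : Finset (Fin n)) :
    koszulDiff r z (T.map (Fin.castAddEmb m)) =
      koszulDiff (fun i => r (Fin.castAdd m i)) (fun U => z (U.map (Fin.castAddEmb m))) T := by
  rw [koszulDiff_apply, koszulDiff_apply]
  have : Tᶜ.map (Fin.castAddEmb m) ⊆ (T.map (Fin.castAddEmb m))ᶜ := by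
    intro v hv
    rw [Finset.mem_map] at hv
    obtain ⟨i, hi, rfl⟩ := hv
    rw [Finset.mem_compl, Finset.mem_map']
    simpa using hi
  rw [← Finset.sum_subset this, Finset.sum_map]
  · refine Finset.sum_congr rfl fun v _ => ?_
    rw [Finset.map_insert, Finset.filter_map, Finset.card_map]
    rfl
  · intro v hv hv'
    rw [hz, smul_zero]
    intro h
    have h1 := h (Finset.mem_insert_self v _)
    rw [Finset.mem_map] at h1
    obtain ⟨i, -, rfl⟩ := h1
    rw [Finset.mem_compl, Finset.mem_map'] at hv
    rw [Finset.mem_map'] at hv'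
    simp at hv'
    exact hv hv'

/-- Passing from the Koszul complex of the subsequence of the first `n` elements of a sequence to
the Koszul complex of the sequence of length `n`. -/
theorem KoszulExactOn.castAdd {n m : ℕ} {r : Fin (n + m) → R} {e : Fin (n + m) → G}
    {𝓜 : G → Submodule K M} {u α : G} (he : ∀ i : Fin n, e (Fin.castAdd m i) = u)
    (h : KoszulExactOn r e 𝓜 u (Finset.univ.map (Fin.castAddEmb m)) α) :
    KoszulExact (fun i => r (Fin.castAdd m i)) (fun _ => 𝓜 α) (fun _ => 𝓜 (α - u)) := by
  intro z hz hz0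
  set pre : Finset (Fin (n + m)) → Finset (Fin n) := fun U =>
    Finset.univ.filter fun i => Fin.castAdd m i ∈ U with hpre
  have hpremap : ∀ T : Finset (Fin n), pre (T.map (Fin.castAddEmb m)) = T := by
    intro T; ext i
    simp only [hpre, Finset.mem_filter, Finset.mem_univ, true_and]
    exact Finset.mem_map' (Fin.castAddEmb m)
  have hmappre : ∀ U : Finset (Fin (n + m)), U ⊆ Finset.univ.map (Fin.castAddEmb m) →
      (pre U).map (Fin.castAddEmb m) = U := by
    intro U hU
    ext v
    constructor
    · intro hv
      obtain ⟨i, hi, rfl⟩ := Finset.mem_map.1 hv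
      simpa [hpre] using hi
    · intro hv
      obtain ⟨i, -, rfl⟩ := Finset.mem_map.1 (hU hv)
      rw [Finset.mem_map']
      simpa [hpre] using hv
  -- All remaining elements have degree `u`, so the twist `|T| u - ∑ e_v` vanishes and the
  -- components no longer depend on `T`.
  have hdeg : ∀ (T : Finset (Fin n)) (γ : G), γ + (T.map (Fin.castAddEmb m)).card • u -
      ∑ v ∈ T.map (Fin.castAddEmb m), e v = γ := by
    intro T γ
    rw [Finset.sum_map, Finset.card_map]
    have : ∑ x ∈ T, e ((Fin.castAddEmb m) x) = T.card • u := by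
      rw [← Finset.sum_const]; exact Finset.sum_congr rfl fun i _ => he i
    rw [this]; abel
  set z' : Finset (Fin (n + m)) → M := fun U =>
    if U ⊆ Finset.univ.map (Fin.castAddEmb m) then z (pre U) else 0 with hz'
  have hsub : ∀ T : Finset (Fin n), T.map (Fin.castAddEmb m) ⊆
      Finset.univ.map (Fin.castAddEmb m) := fun T => Finset.map_subset_map.2 (Finset.subset_univ _)
  have hz'0 : ∀ U, ¬ U ⊆ Finset.univ.map (Fin.castAddEmb m) → z' U = 0 := fun U hU => by
    simp only [hz', hU, if_false]
  have hz'z : (fun U : Finset (Fin n) => z' (U.map (Fin.castAddEmb m))) = z := by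
    funext T
    simp only [hz', hsub, if_true, hpremap]
  obtain ⟨w, hw, hwz⟩ := h z' (fun U => by
    rw [mem_ite_bot]
    refine ⟨fun hU => ?_, hz'0 U⟩
    simp only [hz', hU, if_true]
    rw [← hmappre U hU, hdeg]
    exact hz _) (by
      funext U
      by_cases hU : U ⊆ Finset.univ.map (Fin.castAddEmb m)
      · rw [← hmappre U hU, koszulDiff_append_map r hz'0, hz'z, hz0]; rfl
      · exact koszulDiff_apply_eq_zero fun v _ => hz'0 _ fun h =>
          hU ((Finset.subset_insert _ _).trans h))
  simp only [mem_ite_bot] at hw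
  refine ⟨fun T => w (T.map (Fin.castAddEmb m)), fun T => ?_, ?_⟩
  · have := (hw _).1 (hsub T)
    rwa [hdeg] at this
  · funext T
    rw [← koszulDiff_append_map r fun U => (hw U).2, hwz]
    exact congrFun hz'z T

end KoszulRestrict

/-! ### Comparing Koszul complexes on different modules. -/

section KoszulTransport

variable {R R' R'' M M' M'' : Type*} [CommRing R] [CommRing R'] [CommRing R'']
  [AddCommGroup M] [AddCommGroup M'] [AddCommGroup M''] [Module R M] [Module R' M']
  [Module R'' M''] {N : ℕ}

theorem koszulDiff_comp (φ : M →+ M') {r : Fin N → R} {s : Fin N → R'}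
    (h : ∀ v x, φ (r v • x) = s v • φ x) (z : Finset (Fin N) → M) :
    koszulDiff s (fun T => φ (z T)) = fun T => φ (koszulDiff r z T) := by
  funext T
  rw [koszulDiff_apply, koszulDiff_apply, map_sum]
  refine Finset.sum_congr rfl fun v _ => ?_
  rcases Nat.even_or_odd (T.filter (· < v)).card with h' | h'
  · simp [h'.neg_one_pow, h]
  · simp [h'.neg_one_pow, h]

variable {K : Type*} [Field K] [Module K M] [Module K M']

/-- Exactness of a Koszul complex in terms of chains of another module, if the components of the two
modules have the same images in a third one. -/
theorem koszulExact_iff_of_image_eq (φ : M →+ M'') (ι : M' →+ M'')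
    (hι : Function.Injective ι) {r : Fin N → R} {r' : Fin N → R'} {s : Fin N → R''}
    (hφ : ∀ v x, φ (r v • x) = s v • φ x) (hι' : ∀ v x, ι (r' v • x) = s v • ι x)
    {𝓐 𝓑 : Finset (Fin N) → Submodule K M} {𝓐' 𝓑' : Finset (Fin N) → Submodule K M'}
    (hA : ∀ T, ι '' (𝓐' T : Set M') = φ '' (𝓐 T : Set M))
    (hB : ∀ T, ι '' (𝓑' T : Set M') = φ '' (𝓑 T : Set M)) :
    KoszulExact r' 𝓐' 𝓑' ↔ ∀ z : Finset (Fin N) → M, (∀ T, z T ∈ 𝓐 T) →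
      (∀ T, φ (koszulDiff r z T) = 0) →
        ∃ w : Finset (Fin N) → M, (∀ T, w T ∈ 𝓑 T) ∧ ∀ T, φ (z T - koszulDiff r w T) = 0 := by
  -- Chains are carried between `M` and `M'` one component at a time through their common images in
  -- `M''`; only `ι` is injective, so on the side of `M` everything holds modulo `ker φ`.
  have down : ∀ {𝓒 : Finset (Fin N) → Submodule K M} {𝓒' : Finset (Fin N) → Submodule K M'},
      (∀ T, ι '' (𝓒' T : Set M') = φ '' (𝓒 T : Set M)) → ∀ z : Finset (Fin N) → M,
      (∀ T, z T ∈ 𝓒 T) → ∃ z' : Finset (Fin N) → M', (∀ T, z' T ∈ 𝓒' T) ∧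
        ∀ T, ι (z' T) = φ (z T) := by
    intro 𝓒 𝓒' h z hz
    have : ∀ T, ∃ x, x ∈ 𝓒' T ∧ ι x = φ (z T) := fun T => by
      have : φ (z T) ∈ ι '' (𝓒' T : Set M') := by rw [h]; exact ⟨_, hz T, rfl⟩
      exact this
    choose z' h1 h2 using this
    exact ⟨z', h1, h2⟩
  have up : ∀ {𝓒 : Finset (Fin N) → Submodule K M} {𝓒' : Finset (Fin N) → Submodule K M'},
      (∀ T, ι '' (𝓒' T : Set M') = φ '' (𝓒 T : Set M)) → ∀ z' : Finset (Fin N) → M',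
      (∀ T, z' T ∈ 𝓒' T) → ∃ z : Finset (Fin N) → M, (∀ T, z T ∈ 𝓒 T) ∧
        ∀ T, ι (z' T) = φ (z T) := by
    intro 𝓒 𝓒' h z' hz
    have : ∀ T, ∃ x, x ∈ 𝓒 T ∧ φ x = ι (z' T) := fun T => by
      have : ι (z' T) ∈ φ '' (𝓒 T : Set M) := by rw [← h]; exact ⟨_, hz T, rfl⟩
      exact this
    choose z h1 h2 using this
    exact ⟨z, h1, fun T => (h2 T).symm⟩
  have comm : ∀ (z : Finset (Fin N) → M) (z' : Finset (Fin N) → M'),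
      (∀ T, ι (z' T) = φ (z T)) → ∀ T, ι (koszulDiff r' z' T) = φ (koszulDiff r z T) := by
    intro z z' h T
    rw [← congrFun (koszulDiff_comp ι hι' z') T, ← congrFun (koszulDiff_comp φ hφ z) T]
    simp only [h]
  constructor
  · intro h z hz hz0
    obtain ⟨z', hz', hzz'⟩ := down hA z hz
    obtain ⟨w', hw', hwz'⟩ := h z' hz' (by
      funext T; apply hι; rw [comm z z' hzz', hz0, Pi.zero_apply, map_zero])
    obtain ⟨w, hw, hww'⟩ := up hB w' hw'
    refine ⟨w, hw, fun T => ?_⟩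
    rw [map_sub, ← comm w w' hww', ← hzz', hwz', sub_self]
  · intro h z' hz' hz0
    obtain ⟨z, hz, hzz'⟩ := up hA z' hz'
    obtain ⟨w, hw, hwz⟩ := h z hz (fun T => by rw [← comm z z' hzz', hz0]; simp)
    obtain ⟨w', hw', hww'⟩ := down hB w hw
    refine ⟨w', hw', ?_⟩
    funext T
    apply hι
    rw [comm w w' hww', hzz', ← sub_eq_zero, ← map_sub, ← neg_sub, map_neg, hwz, neg_zero]

end KoszulTransport

/-! ### Bihomogeneous ideals and sections by linear forms in x. -/

section Bihomogeneous

variable {K : Type*} [Field K] {n m : ℕ}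

variable (K n m) in
/-- The component of bidegree `δ` of `S`. -/
noncomputable abbrev biPart (δ : ℤ × ℤ) : Submodule K (BiPoly K n m) :=
  weightedHomogeneousSubmodule K (biWeight n m) δ

/-- An ideal which contains the bihomogeneous components of its elements. -/
def IsBihomogeneous (L : Ideal (BiPoly K n m)) : Prop :=
  ∀ p ∈ L, ∀ δ, weightedHomogeneousComponent (biWeight n m) δ p ∈ L

theorem weight_biWeight (s : Fin n ⊕ Fin m →₀ ℕ) :
    Finsupp.weight (biWeight n m) s = ((xDeg s : ℤ), (yDeg s : ℤ)) := by
  rw [Finsupp.weight_apply, Finsupp.sum_fintype _ _ (by simp), Fintype.sum_sum_type]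
  simp [biWeight, xDeg, yDeg, Prod.ext_iff, Prod.fst_sum, Prod.snd_sum]

theorem mem_biPart_iff {δ : ℤ × ℤ} {p : BiPoly K n m} :
    p ∈ biPart K n m δ ↔ ∀ s ∈ p.support, (xDeg s : ℤ) = δ.1 ∧ (yDeg s : ℤ) = δ.2 := by
  rw [mem_weightedHomogeneousSubmodule, IsWeightedHomogeneous]
  simp only [weight_biWeight, mem_support_iff, Prod.ext_iff]

theorem biPart_eq_zero {δ : ℤ × ℤ} (h : δ.1 < 0 ∨ δ.2 < 0) {p : BiPoly K n m}
    (hp : p ∈ biPart K n m δ) : p = 0 := by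
  rw [← support_eq_empty, Finset.eq_empty_iff_forall_notMem]
  intro s hs
  have := mem_biPart_iff.1 hp s hs
  omega

theorem mul_mem_biPart {δ ε γ : ℤ × ℤ} {p q : BiPoly K n m} (hp : p ∈ biPart K n m δ)
    (hq : q ∈ biPart K n m ε) (h : δ + ε = γ) : p * q ∈ biPart K n m γ :=
  h ▸ IsWeightedHomogeneous.mul hp hq

theorem X_inl_mem_biPart (i : Fin n) : (X (Sum.inl i) : BiPoly K n m) ∈ biPart K n m (1, 0) :=
  isWeightedHomogeneous_X K _ _

theorem C_mem_biPart (c : K) : (C c : BiPoly K n m) ∈ biPart K n m 0 :=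
  isWeightedHomogeneous_C _ _

theorem component_mem_biPart (δ : ℤ × ℤ) (p : BiPoly K n m) :
    weightedHomogeneousComponent (biWeight n m) δ p ∈ biPart K n m δ :=
  weightedHomogeneousComponent_isWeightedHomogeneous _ _

theorem component_of_mem_biPart {δ : ℤ × ℤ} {p : BiPoly K n m} (h : p ∈ biPart K n m δ) :
    weightedHomogeneousComponent (biWeight n m) δ p = p :=
  IsWeightedHomogeneous.weightedHomogeneousComponent_same h

theorem component_mul_of_mem_biPart {ε : ℤ × ℤ} {l : BiPoly K n m} (hl : l ∈ biPart K n m ε)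
    (δ : ℤ × ℤ) (q : BiPoly K n m) :
    weightedHomogeneousComponent (biWeight n m) δ (l * q) =
      l * weightedHomogeneousComponent (biWeight n m) (δ - ε) q := by
  induction q using MvPolynomial.induction_on' with
  | monomial s c =>
    have hs : (monomial s c : BiPoly K n m) ∈ biPart K n m (Finsupp.weight (biWeight n m) s) :=
      isWeightedHomogeneous_monomial _ _ _ rfl
    rw [weightedHomogeneousComponent_of_mem hs,
      weightedHomogeneousComponent_of_mem (mul_mem_biPart hl hs rfl)]
    by_cases h : δ = ε + Finsupp.weight (biWeight n m) s
    · rw [if_pos h, if_pos (by rw [h]; abel)]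
    · rw [if_neg h, if_neg (by rintro h'; apply h; rw [← h']; abel), mul_zero]
  | add p q hp hq => rw [mul_add, map_add, hp, hq, map_add, mul_add]

theorem exists_sub_mul_mem {L : Ideal (BiPoly K n m)} (hL : IsBihomogeneous L) {ε δ : ℤ × ℤ}
    {l : BiPoly K n m} (hl : l ∈ biPart K n m ε) {z : BiPoly K n m} (hz : z ∈ biPart K n m δ)
    (hzL : z ∈ L ⊔ Ideal.span {l}) : ∃ u ∈ biPart K n m (δ - ε), z - l * u ∈ L := by
  obtain ⟨p, hp, q', hq', rfl⟩ := Submodule.mem_sup.1 hzL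
  obtain ⟨q, rfl⟩ := Ideal.mem_span_singleton.1 hq'
  refine ⟨_, component_mem_biPart (δ - ε) q, ?_⟩
  rw [← component_mul_of_mem_biPart hl]
  nth_rw 1 [← component_of_mem_biPart hz]
  rw [map_add, add_sub_cancel_right]
  exact hL p hp δ

theorem IsBihomogeneous.sup_span_singleton {L : Ideal (BiPoly K n m)} (hL : IsBihomogeneous L)
    {ε : ℤ × ℤ} {l : BiPoly K n m} (hl : l ∈ biPart K n m ε) :
    IsBihomogeneous (L ⊔ Ideal.span {l}) := by
  intro z hz δ
  obtain ⟨p, hp, q', hq', rfl⟩ := Submodule.mem_sup.1 hz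
  obtain ⟨q, rfl⟩ := Ideal.mem_span_singleton.1 hq'
  rw [map_add, component_mul_of_mem_biPart hl]
  exact add_mem (Ideal.mem_sup_left (hL p hp δ))
    (Ideal.mem_sup_right (Ideal.mul_mem_right _ _ (Ideal.mem_span_singleton_self l)))

/-- The Koszul differential of `x_1, …, x_n` on `S`. -/
noncomputable abbrev xDiff (K : Type*) [Field K] (n m : ℕ) :
    (Finset (Fin n) → BiPoly K n m) →ₗ[BiPoly K n m] (Finset (Fin n) → BiPoly K n m) :=
  koszulDiff fun v : Fin n => (X (Sum.inl v) : BiPoly K n m)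

theorem koszulDiff_mem_ideal {R : Type*} [CommRing R] {N : ℕ} (r : Fin N → R) {L : Ideal R}
    {z : Finset (Fin N) → R} (hz : ∀ T, z T ∈ L) (T : Finset (Fin N)) :
    koszulDiff r z T ∈ L := by
  rw [koszulDiff_apply]
  exact sum_mem fun v _ => L.mul_mem_left _ (hz _)

theorem xDiff_mem_biPart {δ γ : ℤ × ℤ} (h : δ + (1, 0) = γ) {z : Finset (Fin n) → BiPoly K n m}
    (hz : ∀ T, z T ∈ biPart K n m δ) (T : Finset (Fin n)) :
    xDiff K n m z T ∈ biPart K n m γ := by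
  rw [xDiff, koszulDiff_apply]
  refine sum_mem fun v _ => ?_
  rw [mul_smul, neg_one_pow_smul_mem]
  exact mul_mem_biPart (X_inl_mem_biPart v) (hz _) (by rw [← h, add_comm])

/-- Exactness modulo `L` of the strand `a` of the Koszul complex of `x_1, …, x_n` on `S`, in
`y`-degree `j`. -/
def StrandExactMod (L : Ideal (BiPoly K n m)) (j a : ℤ) : Prop :=
  ∀ z : Finset (Fin n) → BiPoly K n m, (∀ T, z T ∈ biPart K n m (a, j)) →
    (∀ T, xDiff K n m z T ∈ L) → ∃ w : Finset (Fin n) → BiPoly K n m,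
      (∀ T, w T ∈ biPart K n m (a - 1, j)) ∧ ∀ T, z T - xDiff K n m w T ∈ L

/-- Multiplication by the linear form `l` is injective on the component of bidegree `(a, j)` of
`S / L`. -/
def RegularAt (L : Ideal (BiPoly K n m)) (l : BiPoly K n m) (j a : ℤ) : Prop :=
  ∀ p ∈ biPart K n m (a, j), l * p ∈ L → p ∈ L

/-- The linear form with coefficients `c` in the `x`-variables. -/
noncomputable def xForm (m : ℕ) (c : Fin n → K) : BiPoly K n m :=
  ∑ v, C (c v) * X (Sum.inl v)

theorem xForm_mem_biPart (c : Fin n → K) : xForm m c ∈ biPart K n m (1, 0) :=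
  sum_mem fun v _ => mul_mem_biPart (C_mem_biPart _) (X_inl_mem_biPart v) (zero_add _)

/-- The homotopy between `0` and multiplication by the linear form `∑ c_v x_v`. -/
noncomputable def xHomotopy (c : Fin n → K) :
    (Finset (Fin n) → BiPoly K n m) →ₗ[BiPoly K n m] (Finset (Fin n) → BiPoly K n m) :=
  ∑ v, (C (c v) : BiPoly K n m) • koszulWedge (R := BiPoly K n m) v

theorem xDiff_xHomotopy (c : Fin n → K) (u : Finset (Fin n) → BiPoly K n m) :
    xDiff K n m (xHomotopy c u) = xForm m c • u - xHomotopy c (xDiff K n m u) := by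
  simp only [xHomotopy, LinearMap.sum_apply, LinearMap.smul_apply, map_sum, map_smul,
    koszulDiff_wedge, xForm, Finset.sum_smul, smul_sub, Finset.sum_sub_distrib, mul_smul]

theorem xHomotopy_mem_ideal (c : Fin n → K) {L : Ideal (BiPoly K n m)}
    {z : Finset (Fin n) → BiPoly K n m} (hz : ∀ T, z T ∈ L) (T : Finset (Fin n)) :
    xHomotopy c z T ∈ L := by
  rw [xHomotopy, LinearMap.sum_apply, Finset.sum_apply]
  refine sum_mem fun v _ => L.mul_mem_left _ ?_
  by_cases hv : v ∈ T
  · rw [koszulWedge_apply_of_mem hv]; exact L.mul_mem_left _ (hz _)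
  · rw [koszulWedge_apply_of_notMem hv]; exact zero_mem _

theorem xHomotopy_mem_biPart (c : Fin n → K) {δ : ℤ × ℤ}
    {z : Finset (Fin n) → BiPoly K n m} (hz : ∀ T, z T ∈ biPart K n m δ) (T : Finset (Fin n)) :
    xHomotopy c z T ∈ biPart K n m δ := by
  rw [xHomotopy, LinearMap.sum_apply, Finset.sum_apply]
  refine sum_mem fun v _ => mul_mem_biPart (C_mem_biPart _) ?_ (zero_add _)
  by_cases hv : v ∈ T
  · rw [koszulWedge_apply_of_mem hv, neg_one_pow_smul_mem]; exact hz _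
  · rw [koszulWedge_apply_of_notMem hv]; exact zero_mem _

/-- Modulo `L` write `z = ∂w + l u`. Then `∂z ∈ L` gives `l ∂u ∈ L`, so `∂u ∈ L` by regularity, and
`l u` is modulo `L` the boundary of `h u`, where `h` is the homotopy for `l`. -/
theorem StrandExactMod.of_sup {L : Ideal (BiPoly K n m)} (hL : IsBihomogeneous L) {c : Fin n → K}
    {j a : ℤ} (hreg : RegularAt L (xForm m c) j a)
    (h : StrandExactMod (L ⊔ Ideal.span {xForm m c}) j a) : StrandExactMod L j a := by
  intro z hz hzL
  obtain ⟨w, hw, hwz⟩ := h z hz fun T => Ideal.mem_sup_left (hzL T)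
  have : ∀ T, ∃ u ∈ biPart K n m (a - 1, j),
      z T - xDiff K n m w T - xForm m c * u ∈ L := by
    intro T
    obtain ⟨u, hu, h⟩ := exists_sub_mul_mem hL (xForm_mem_biPart c)
      (sub_mem (hz T) (xDiff_mem_biPart (by simp) hw T)) (hwz T)
    exact ⟨u, by simpa using hu, h⟩
  choose u hu huL using this
  have huL' : ∀ T, xForm m c * xDiff K n m u T ∈ L := by
    intro T
    have h1 := koszulDiff_mem_ideal (fun v : Fin n => (X (Sum.inl v) : BiPoly K n m))
      (z := z - xDiff K n m w - xForm m c • u) huL T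
    rw [map_sub, map_sub, koszulDiff_koszulDiff, sub_zero, map_smul] at h1
    have := sub_mem (hzL T) h1
    simpa using this
  have hdu : ∀ T, xDiff K n m u T ∈ L := fun T =>
    hreg _ (xDiff_mem_biPart (by simp) hu T) (huL' T)
  refine ⟨w + xHomotopy c u, fun T => add_mem (hw T) (xHomotopy_mem_biPart c hu T), fun T => ?_⟩
  rw [map_add, xDiff_xHomotopy]
  have := add_mem (huL T) (xHomotopy_mem_ideal c hdu T)
  convert this using 1
  simp only [Pi.add_apply, Pi.sub_apply, Pi.smul_apply, smul_eq_mul]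
  ring

/-- A socle argument. Regularity in degree `a + 1` puts every `x_v p` into `L`, so `p e_1 ∧ … ∧ e_n`
is a cycle modulo `L`. There are no boundaries in top exterior degree, so exactness forces `p ∈ L`.
-/
theorem RegularAt.of_strandExactMod {L : Ideal (BiPoly K n m)} {l : BiPoly K n m} {j a : ℤ}
    (h : StrandExactMod L j a) (h' : RegularAt L l j (a + 1)) : RegularAt L l j a := by
  classical
  intro p hp hlp
  obtain ⟨w, -, hw⟩ := h (Pi.single Finset.univ p) (fun T => by
      by_cases hT : T = Finset.univ
      · subst hT; simpa using hp
      · rw [Pi.single_eq_of_ne hT]; exact zero_mem _) (fun T => by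
      rw [xDiff, koszulDiff_apply]
      refine sum_mem fun v _ => ?_
      by_cases hT : insert v T = Finset.univ
      · rw [hT, Pi.single_eq_same, mul_smul]
        refine L.mul_mem_left _ (h' _ (mul_mem_biPart (X_inl_mem_biPart v) hp (by simp [add_comm])) ?_)
        rw [smul_eq_mul, mul_left_comm]
        exact L.mul_mem_left _ hlp
      · rw [Pi.single_eq_of_ne hT, smul_zero]; exact zero_mem _)
  have := hw Finset.univ
  rwa [xDiff, koszulDiff_apply, Finset.compl_univ, Finset.sum_empty, sub_zero,
    Pi.single_eq_same] at this

/-- If `∂z = l u` modulo `L`, then `l ∂u ∈ L`, and regularity one degree higher gives `∂u ∈ L`. So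
`u = ∂w` modulo `L`, and exactness on `S / L` applies to the cycle `z - l w`. -/
theorem StrandExactMod.sup {L : Ideal (BiPoly K n m)} (hL : IsBihomogeneous L) {c : Fin n → K}
    {j a : ℤ} (h : StrandExactMod L j a) (hreg : RegularAt L (xForm m c) j (a + 1)) :
    StrandExactMod (L ⊔ Ideal.span {xForm m c}) j a := by
  intro z hz hzL
  have : ∀ T, ∃ u ∈ biPart K n m (a, j), xDiff K n m z T - xForm m c * u ∈ L := by
    intro T
    obtain ⟨u, hu, h⟩ := exists_sub_mul_mem hL (xForm_mem_biPart c)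
      (xDiff_mem_biPart (γ := (a + 1, j)) (by simp) hz T) (hzL T)
    exact ⟨u, by simpa using hu, h⟩
  choose u hu huL using this
  have hdu : ∀ T, xDiff K n m u T ∈ L := by
    intro T
    refine hreg _ (xDiff_mem_biPart (by simp) hu T) ?_
    have h1 := koszulDiff_mem_ideal (fun v : Fin n => (X (Sum.inl v) : BiPoly K n m))
      (z := xDiff K n m z - xForm m c • u) huL T
    rw [map_sub, koszulDiff_koszulDiff, zero_sub, map_smul] at h1
    simpa using h1
  obtain ⟨w, hw, hwu⟩ := h u hu hdu
  obtain ⟨q, hq, hqz⟩ := h (z - xForm m c • w) (fun T => sub_mem (hz T)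
      (mul_mem_biPart (xForm_mem_biPart c) (hw T) (by simp))) (fun T => by
      rw [map_sub, map_smul]
      have := add_mem (huL T) (L.mul_mem_left (xForm m c) (hwu T))
      convert this using 1
      simp only [Pi.sub_apply, Pi.smul_apply, smul_eq_mul]
      ring)
  refine ⟨q, hq, fun T => ?_⟩
  have := add_mem (Ideal.mem_sup_left (T := Ideal.span {xForm m c}) (hqz T))
    (Ideal.mem_sup_right (S := L) (Ideal.mul_mem_right (w T) _
      (Ideal.mem_span_singleton_self (xForm m c))))
  convert this using 1
  simp only [Pi.sub_apply, Pi.smul_apply, smul_eq_mul]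
  ring

/-- If `l` is a linear form which is regular on `S / L` in high `x`-degrees, then the strands
`a > r` of the Koszul complex on `S / L` are exact if and only if `l` is regular on `S / L` in
degrees `a > r` and these strands are exact on `S / (L, l)`. -/
theorem forall_strandExactMod_iff {L : Ideal (BiPoly K n m)} (hL : IsBihomogeneous L)
    {c : Fin n → K} {j : ℤ} {D : ℤ} (hD : ∀ a ≥ D, RegularAt L (xForm m c) j a) (r : ℤ) :
    (∀ a > r, StrandExactMod L j a) ↔ (∀ a > r, RegularAt L (xForm m c) j a) ∧
      ∀ a > r, StrandExactMod (L ⊔ Ideal.span {xForm m c}) j a := by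
  constructor
  · intro h
    -- Descending induction from `D`: the socle argument carries regularity from `a + 1` down to
    -- `a`.
    have hreg : ∀ a > r, RegularAt L (xForm m c) j a := by
      intro a ha
      obtain ⟨k, hk⟩ : ∃ k : ℕ, D ≤ a + k := ⟨(D - a).toNat, by omega⟩
      induction k generalizing a with
      | zero => exact hD a (by simpa using hk)
      | succ k ih =>
        exact .of_strandExactMod (h a ha) (ih (a + 1) (by omega) (by push_cast at hk; omega))
    exact ⟨hreg, fun a ha => (h a ha).sup hL (hreg (a + 1) (by omega))⟩
  · rintro ⟨h1, h2⟩ a ha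
    exact (h2 a ha).of_sup hL (h1 a ha)

end Bihomogeneous

/-! ### The term order. -/

section TermOrder

variable {n m : ℕ}

theorem xDeg_add (s t : Fin n ⊕ Fin m →₀ ℕ) : xDeg (s + t) = xDeg s + xDeg t := by
  simp [xDeg, Finset.sum_add_distrib]

theorem yDeg_add (s t : Fin n ⊕ Fin m →₀ ℕ) : yDeg (s + t) = yDeg s + yDeg t := by
  simp [yDeg, Finset.sum_add_distrib]

theorem xDeg_single_inl (i : Fin n) :
    xDeg (Finsupp.single (Sum.inl i) 1 : Fin n ⊕ Fin m →₀ ℕ) = 1 := by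
  simp [xDeg, Finsupp.single_apply]

theorem yDeg_single_inl (i : Fin n) :
    yDeg (Finsupp.single (Sum.inl i) 1 : Fin n ⊕ Fin m →₀ ℕ) = 0 := by
  simp [yDeg]

theorem xDeg_single_inr (j : Fin m) :
    xDeg (Finsupp.single (Sum.inr j) 1 : Fin n ⊕ Fin m →₀ ℕ) = 0 := by
  simp [xDeg]

theorem yDeg_single_inr (j : Fin m) :
    yDeg (Finsupp.single (Sum.inr j) 1 : Fin n ⊕ Fin m →₀ ℕ) = 1 := by
  simp [yDeg, Finsupp.single_apply]

theorem le_xDeg_add_yDeg (s : Fin n ⊕ Fin m →₀ ℕ) (a : Fin n ⊕ Fin m) :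
    s a ≤ xDeg s + yDeg s := by
  rcases a with i | j
  · exact (Finset.single_le_sum (f := fun i => s (Sum.inl i)) (fun _ _ => Nat.zero_le _)
      (Finset.mem_univ i)).trans (Nat.le_add_right _ _)
  · exact (Finset.single_le_sum (f := fun i => s (Sum.inr i)) (fun _ _ => Nat.zero_le _)
      (Finset.mem_univ j)).trans (Nat.le_add_left _ _)

theorem finite_setOf_deg_le (D : ℕ) : {s : Fin n ⊕ Fin m →₀ ℕ | xDeg s + yDeg s ≤ D}.Finite :=
  (Set.finite_Iic (Finsupp.equivFunOnFinite.symm fun _ => D)).subset fun s hs a =>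
    (le_xDeg_add_yDeg s a).trans hs

/-- The list `x_n, …, x_1, y_m, …, y_1` of the variables. -/
def revVar (k : Fin (n + m)) : Fin n ⊕ Fin m :=
  Fin.addCases (fun i => Sum.inl i.rev) (fun j => Sum.inr j.rev) k

theorem exists_revVar_eq (a : Fin n ⊕ Fin m) : ∃ k, revVar k = a := by
  rcases a with i | j
  · exact ⟨Fin.castAdd m i.rev, by simp [revVar]⟩
  · exact ⟨Fin.natAdd n j.rev, by simp [revVar]⟩

theorem termKey_lt_iff {s t : Fin n ⊕ Fin m →₀ ℕ} : termKey s < termKey t ↔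
    xDeg s + yDeg s < xDeg t + yDeg t ∨ xDeg s + yDeg s = xDeg t + yDeg t ∧
      (yDeg s < yDeg t ∨ yDeg s = yDeg t ∧ (xDeg s < xDeg t ∨ xDeg s = xDeg t ∧
        ∃ k, (∀ k' < k, s (revVar k') = t (revVar k')) ∧ t (revVar k) < s (revVar k))) := by
  have key : ∀ u : Fin n ⊕ Fin m →₀ ℕ, (Fin.append
      (fun i : Fin n => OrderDual.toDual (u (Sum.inl i.rev)))
      (fun j : Fin m => OrderDual.toDual (u (Sum.inr j.rev)))) =
      fun k => OrderDual.toDual (u (revVar k)) := by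
    intro u; funext k
    refine Fin.addCases (fun i => ?_) (fun j => ?_) k <;> simp [revVar]
  simp only [termKey, key, Prod.Lex.toLex_lt_toLex]
  rfl

theorem termKey_injective : Function.Injective (termKey (n := n) (m := m)) := by
  intro s t h
  by_contra hne
  have hdeg : xDeg s + yDeg s = xDeg t + yDeg t ∧ yDeg s = yDeg t := by
    have h1 := lt_irrefl (termKey t)
    have h2 : ¬ termKey s < termKey t := h ▸ h1
    have h3 : ¬ termKey t < termKey s := h ▸ h1
    rw [termKey_lt_iff] at h2 h3
    omega
  have hk : ∃ k : Fin (n + m), s (revVar k) ≠ t (revVar k) := by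
    by_contra hk
    push Not at hk
    refine hne (Finsupp.ext fun a => ?_)
    obtain ⟨k, rfl⟩ := exists_revVar_eq a
    exact hk k
  classical
  obtain ⟨k, hk, hmin⟩ := WellFounded.has_min (wellFounded_lt (α := Fin (n + m)))
    {k | s (revVar k) ≠ t (revVar k)} hk
  have hmin' : ∀ k' < k, s (revVar k') = t (revVar k') := fun k' hk' => by
    by_contra h; exact hmin k' h hk'
  rcases lt_or_gt_of_ne (show s (revVar k) ≠ t (revVar k) from hk) with h' | h'
  · refine (termKey_lt_iff.2 (Or.inr ⟨hdeg.1.symm, Or.inr ⟨hdeg.2.symm, Or.inr ⟨by omega, k,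
      fun k' hk' => (hmin' k' hk').symm, h'⟩⟩⟩)).ne h.symm
  · refine (termKey_lt_iff.2 (Or.inr ⟨hdeg.1, Or.inr ⟨hdeg.2, Or.inr ⟨by omega, k,
      fun k' hk' => hmin' k' hk', h'⟩⟩⟩)).ne h

theorem termKey_add_lt {s t : Fin n ⊕ Fin m →₀ ℕ} (u : Fin n ⊕ Fin m →₀ ℕ) :
    termKey (u + s) < termKey (u + t) ↔ termKey s < termKey t := by
  simp only [termKey_lt_iff, xDeg_add, yDeg_add, Finsupp.add_apply, add_right_inj,
    add_lt_add_iff_left]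
  rw [show xDeg u + xDeg s + (yDeg u + yDeg s) = (xDeg u + yDeg u) + (xDeg s + yDeg s) by ring,
    show xDeg u + xDeg t + (yDeg u + yDeg t) = (xDeg u + yDeg u) + (xDeg t + yDeg t) by ring]
  simp only [add_right_inj, add_lt_add_iff_left]

theorem deg_le_of_termKey_lt {s t : Fin n ⊕ Fin m →₀ ℕ} (h : termKey s < termKey t) :
    xDeg s + yDeg s ≤ xDeg t + yDeg t := by
  rw [termKey_lt_iff] at h; omega

/-- Within a bidegree the exponents of `x_n, x_{n-1}, …` are compared first, so the last differing
`x`-variable decides, whatever the `y`-exponents are. -/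
theorem termKey_lt_of_inl {s t : Fin n ⊕ Fin m →₀ ℕ} (hx : xDeg s = xDeg t)
    (hy : yDeg s = yDeg t) {i : Fin n} (h : ∀ v > i, s (Sum.inl v) = t (Sum.inl v))
    (hi : t (Sum.inl i) < s (Sum.inl i)) : termKey s < termKey t := by
  refine termKey_lt_iff.2 (Or.inr ⟨by omega, Or.inr ⟨hy, Or.inr ⟨hx, Fin.castAdd m i.rev, ?_, ?_⟩⟩⟩)
  · intro k
    refine Fin.addCases (fun v hv => ?_) (fun v hv => ?_) k
    · have hv' : v < i.rev := hv
      simpa [revVar] using h v.rev (by rw [gt_iff_lt, ← Fin.rev_lt_rev]; simpa using hv')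
    · exfalso
      rw [Fin.lt_def] at hv
      simp only [Fin.val_natAdd, Fin.val_castAdd] at hv
      have := i.rev.2
      omega
  · simpa [revVar] using hi

theorem termKey_lt_of_inr {s t : Fin n ⊕ Fin m →₀ ℕ} (hx : xDeg s = xDeg t)
    (hy : yDeg s = yDeg t) {i : Fin m} (h' : ∀ v, s (Sum.inl v) = t (Sum.inl v))
    (h : ∀ v > i, s (Sum.inr v) = t (Sum.inr v))
    (hi : t (Sum.inr i) < s (Sum.inr i)) : termKey s < termKey t := by
  refine termKey_lt_iff.2 (Or.inr ⟨by omega, Or.inr ⟨hy, Or.inr ⟨hx, Fin.natAdd n i.rev, ?_, ?_⟩⟩⟩)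
  · intro k
    refine Fin.addCases (fun v hv => ?_) (fun v hv => ?_) k
    · simpa [revVar] using h' v.rev
    · have hv' : v < i.rev := by simpa using hv
      simpa [revVar] using h v.rev (by rw [gt_iff_lt, ← Fin.rev_lt_rev]; simpa using hv')
  · simpa [revVar] using hi

/-- `x_i < x_k` for `k < i`, `y_i < y_k` for `k < i`. -/
inductive VarLT : Fin n ⊕ Fin m → Fin n ⊕ Fin m → Prop
  | inl {i k : Fin n} (h : k < i) : VarLT (Sum.inl i) (Sum.inl k)
  | inr {i k : Fin m} (h : k < i) : VarLT (Sum.inr i) (Sum.inr k)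

theorem VarLT.ne {a b : Fin n ⊕ Fin m} (h : VarLT a b) : a ≠ b := by
  rcases h with h | h <;> simp [h.ne']

theorem VarLT.termKey_single_lt {a b : Fin n ⊕ Fin m} (h : VarLT a b) :
    termKey (Finsupp.single a 1) < termKey (Finsupp.single b 1) := by
  rcases h with @⟨i, k, h⟩ | @⟨i, k, h⟩
  · refine termKey_lt_of_inl (by simp [xDeg_single_inl]) (by simp [yDeg_single_inl])
      (i := i) (fun v hv => ?_) ?_
    · simp [hv.ne, (h.trans hv).ne]
    · simp [h.ne]
  · refine termKey_lt_of_inr (by simp [xDeg_single_inr]) (by simp [yDeg_single_inr])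
      (i := i) (fun v => by simp) (fun v hv => ?_) ?_
    · simp [hv.ne, (h.trans hv).ne]
    · simp [h.ne]

end TermOrder

/-! ### Initial monomials and multiplication by x_k modulo the later variables. -/

section Leading

variable {n m : ℕ} {R : Type*} [CommRing R]

/-- `s` is the exponent of the initial monomial of `p`, over an arbitrary coefficient ring. -/
def IsLeading (p : MvPolynomial (Fin n ⊕ Fin m) R) (s : Fin n ⊕ Fin m →₀ ℕ) : Prop :=
  s ∈ p.support ∧ ∀ t ∈ p.support, t ≠ s → termKey t < termKey s

/-- The exponents of the initial monomials of the elements of an ideal. -/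
def leadSet (I : Ideal (MvPolynomial (Fin n ⊕ Fin m) R)) : Set (Fin n ⊕ Fin m →₀ ℕ) :=
  {s | ∃ p ∈ I, IsLeading p s}

theorem exists_isLeading {p : MvPolynomial (Fin n ⊕ Fin m) R} (hp : p ≠ 0) :
    ∃ s, IsLeading p s := by
  obtain ⟨s, hs, hmax⟩ := Finset.exists_max_image p.support termKey
    (Finset.nonempty_of_ne_empty fun h => hp (support_eq_empty.1 h))
  exact ⟨s, hs, fun t ht hts => lt_of_le_of_ne (hmax t ht) fun h => hts (termKey_injective h)⟩

theorem IsLeading.monomial_mul {p : MvPolynomial (Fin n ⊕ Fin m) R} {s : Fin n ⊕ Fin m →₀ ℕ}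
    (h : IsLeading p s) (u : Fin n ⊕ Fin m →₀ ℕ) : IsLeading (monomial u 1 * p) (u + s) := by
  refine ⟨?_, fun t ht hts => ?_⟩
  · rw [mem_support_iff, coeff_monomial_mul, one_mul]
    exact mem_support_iff.1 h.1
  · rw [mem_support_iff, coeff_monomial_mul', ite_ne_right_iff, one_mul] at ht
    obtain ⟨hut, ht⟩ := ht
    obtain ⟨t', rfl⟩ := exists_add_of_le hut
    rw [add_tsub_cancel_left] at ht
    exact (termKey_add_lt u).2 (h.2 t' (mem_support_iff.2 ht) fun h => hts (by rw [h]))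

theorem add_mem_leadSet {I : Ideal (MvPolynomial (Fin n ⊕ Fin m) R)} {s : Fin n ⊕ Fin m →₀ ℕ}
    (hs : s ∈ leadSet I) (u : Fin n ⊕ Fin m →₀ ℕ) : u + s ∈ leadSet I := by
  obtain ⟨p, hp, hps⟩ := hs
  exact ⟨_, I.mul_mem_left _ hp, hps.monomial_mul u⟩

theorem leadSet_mono_le {I : Ideal (MvPolynomial (Fin n ⊕ Fin m) R)} {s t : Fin n ⊕ Fin m →₀ ℕ}
    (hs : s ∈ leadSet I) (h : s ≤ t) : t ∈ leadSet I := by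
  obtain ⟨u, rfl⟩ := exists_add_of_le h
  rw [add_comm]
  exact add_mem_leadSet hs u

variable {K : Type*} [Field K]

theorem initialIdeal_eq_span (J : Ideal (BiPoly K n m)) :
    initialIdeal J = Ideal.span ((fun s => monomial s (1 : K)) '' leadSet J) := by
  rw [initialIdeal]
  congr 1
  ext z
  constructor
  · rintro ⟨p, hp, s, hs, rfl⟩
    exact ⟨s, ⟨p, hp, hs⟩, rfl⟩
  · rintro ⟨s, ⟨p, hp, hs⟩, rfl⟩
    exact ⟨p, hp, s, hs, rfl⟩

theorem monomial_mem_span_iff {B : Set (Fin n ⊕ Fin m →₀ ℕ)} (hB : IsUpperSet B)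
    {s : Fin n ⊕ Fin m →₀ ℕ} :
    monomial s (1 : K) ∈ Ideal.span ((fun s => monomial s (1 : K)) '' B) ↔ s ∈ B := by
  rw [mem_ideal_span_monomial_image]
  classical
  constructor
  · intro h
    obtain ⟨t, ht, hts⟩ := h s (by simp [mem_support_iff])
    exact hB hts ht
  · intro h t ht
    rw [mem_support_iff, coeff_monomial, ite_ne_right_iff] at ht
    exact ⟨s, h, ht.1.le⟩

theorem isUpperSet_leadSet (I : Ideal (MvPolynomial (Fin n ⊕ Fin m) R)) :
    IsUpperSet (leadSet I) := fun _ _ h hs => leadSet_mono_le hs h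

theorem monomial_mem_initialIdeal_iff {J : Ideal (BiPoly K n m)} {s : Fin n ⊕ Fin m →₀ ℕ} :
    monomial s (1 : K) ∈ initialIdeal J ↔ s ∈ leadSet J := by
  rw [initialIdeal_eq_span, monomial_mem_span_iff (isUpperSet_leadSet J)]

theorem support_component_subset (p : BiPoly K n m) (δ : ℤ × ℤ) :
    (weightedHomogeneousComponent (biWeight n m) δ p).support ⊆ p.support := by
  classical
  intro t ht
  rw [mem_support_iff, coeff_weightedHomogeneousComponent] at ht
  rw [mem_support_iff]
  exact fun h => ht (by simp [h])

theorem coeff_component_deg (p : BiPoly K n m) (s : Fin n ⊕ Fin m →₀ ℕ) :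
    coeff s (weightedHomogeneousComponent (biWeight n m) ((xDeg s : ℤ), (yDeg s : ℤ)) p) =
      coeff s p := by
  classical
  rw [coeff_weightedHomogeneousComponent, if_pos (weight_biWeight s)]

theorem exists_homogeneous_of_mem_leadSet {J : Ideal (BiPoly K n m)} (hJ : IsBihomogeneous J)
    {s : Fin n ⊕ Fin m →₀ ℕ} (hs : s ∈ leadSet J) :
    ∃ p ∈ J, p ∈ biPart K n m (xDeg s, yDeg s) ∧ IsLeading p s := by
  obtain ⟨p, hp, hps⟩ := hs
  refine ⟨_, hJ p hp _, component_mem_biPart (xDeg s, yDeg s) p, ?_, fun t ht hts =>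
    hps.2 t (support_component_subset _ _ ht) hts⟩
  rw [mem_support_iff, coeff_component_deg]
  exact mem_support_iff.1 hps.1

/-- The ideal `J + (x_k, …, x_n)` (with variables numbered from `0`). -/
noncomputable def tailIdeal (J : Ideal (BiPoly K n m)) (k : ℕ) : Ideal (BiPoly K n m) :=
  J ⊔ Ideal.span (X '' (Sum.inl '' {v : Fin n | k ≤ v}))

/-- The reverse lexicographic property: in a fixed bidegree a monomial containing a tail variable is
smaller than every monomial containing none. The terms from the tail thus neither produce nor exceed
`s`, which must be the initial exponent of the part in `J`. -/
theorem mem_leadSet_of_mem_tailIdeal {J : Ideal (BiPoly K n m)} (hJ : IsBihomogeneous J) {k : ℕ}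
    {q : BiPoly K n m} (hq : q ∈ tailIdeal J k) {δ : ℤ × ℤ} (hqδ : q ∈ biPart K n m δ)
    {s : Fin n ⊕ Fin m →₀ ℕ} (hs : IsLeading q s)
    (hsk : ∀ v : Fin n, k ≤ v → s (Sum.inl v) = 0) : s ∈ leadSet J := by
  obtain ⟨p, hp, t, ht, hpt⟩ := Submodule.mem_sup.1 hq
  rw [mem_ideal_span_X_image] at ht
  have hpc := hJ p hp δ
  have hδ := component_mem_biPart δ p
  set p' := weightedHomogeneousComponent (biWeight n m) δ p with hp'
  set t' := weightedHomogeneousComponent (biWeight n m) δ t with ht'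
  have hq' : q = p' + t' := by
    rw [← component_of_mem_biPart hqδ, ← hpt, map_add]
  have hst : ∀ u ∈ t'.support, ∃ v : Fin n, k ≤ v ∧ u (Sum.inl v) ≠ 0 := by
    intro u hu
    obtain ⟨_, ⟨v, hv, rfl⟩, hvu⟩ := ht u (support_component_subset _ _ hu)
    exact ⟨v, hv, hvu⟩
  refine ⟨p', hpc, ?_, fun u hu hus => ?_⟩
  · have h0 : coeff s t' = 0 := by
      by_contra h
      obtain ⟨v, hv, hv'⟩ := hst s (mem_support_iff.2 h)
      exact hv' (hsk v hv)
    have := mem_support_iff.1 hs.1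
    rw [hq', coeff_add, h0, add_zero] at this
    exact mem_support_iff.2 this
  · by_cases huq : u ∈ q.support
    · exact hs.2 u huq hus
    · have hut : u ∈ t'.support := by
        rw [notMem_support_iff, hq', coeff_add] at huq
        rw [mem_support_iff] at hu ⊢
        intro h
        rw [h, add_zero] at huq
        exact hu huq
      obtain ⟨v₀, hv₀, hv₀'⟩ := hst u hut
      obtain ⟨v, hv, hmax⟩ := Finset.exists_max_image
        (Finset.univ.filter fun v : Fin n => k ≤ v ∧ u (Sum.inl v) ≠ 0) id
        ⟨v₀, by simp [hv₀, hv₀']⟩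
      simp only [Finset.mem_filter, Finset.mem_univ, true_and, id] at hv hmax
      have h1 := mem_biPart_iff.1 hδ u hu
      have h2 := mem_biPart_iff.1 hqδ s hs.1
      refine termKey_lt_of_inl (by omega) (by omega) (i := v) (fun v' hv' => ?_) ?_
      · have hkv : k ≤ (v' : ℕ) := hv.1.trans (Fin.lt_def.1 hv').le
        rw [hsk v' hkv]
        by_contra h
        exact absurd (hmax v' ⟨hkv, h⟩) (not_le.2 hv')
      · rw [hsk v hv.1]; exact Nat.pos_of_ne_zero hv.2

/-- There is a monomial of bidegree `(a, j)` outside `B` without the variables after `x_k`,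
which is multiplied into `B` by `x_k`. -/
def HasGap (B : Set (Fin n ⊕ Fin m →₀ ℕ)) (k : Fin n) (j a : ℤ) : Prop :=
  ∃ w : Fin n ⊕ Fin m →₀ ℕ, (xDeg w : ℤ) = a ∧ (yDeg w : ℤ) = j ∧
    (∀ v > k, w (Sum.inl v) = 0) ∧ w ∉ B ∧ w + Finsupp.single (Sum.inl k) 1 ∈ B

/-- The order refines total degree, so only finitely many monomials lie below a given one. -/
theorem termKey_wellFounded :
    WellFounded fun s t : Fin n ⊕ Fin m →₀ ℕ => termKey s < termKey t := by
  have : ∀ D : ℕ, ∀ t : Fin n ⊕ Fin m →₀ ℕ, {s | termKey s < termKey t}.ncard ≤ D →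
      Acc (fun s t : Fin n ⊕ Fin m →₀ ℕ => termKey s < termKey t) t := by
    have hfin : ∀ t : Fin n ⊕ Fin m →₀ ℕ, {s | termKey s < termKey t}.Finite := fun t =>
      (finite_setOf_deg_le _).subset fun s hs => deg_le_of_termKey_lt hs
    intro D
    induction D with
    | zero =>
      intro t ht
      refine ⟨t, fun s hs => ?_⟩
      have := (Set.ncard_eq_zero (hfin t)).1 (Nat.le_zero.1 ht)
      exact absurd (show s ∈ {s | termKey s < termKey t} from hs) (by rw [this]; simp)
    | succ D ih =>
      intro t ht
      refine ⟨t, fun s hs => ih s ?_⟩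
      have : {u | termKey u < termKey s}.ncard < {u | termKey u < termKey t}.ncard :=
        Set.ncard_lt_ncard ⟨fun u hu => lt_trans hu hs, fun h =>
          lt_irrefl (termKey s) (h hs)⟩ (hfin t)
      omega
  exact ⟨fun t => this _ t le_rfl⟩

/-- Induction on the initial exponent `s` of `p`: it suffices to find an element of the tail ideal
with the same bidegree and initial exponent, and subtract a multiple. If `s` contains a later
variable, the monomial itself serves. Otherwise the reverse lexicographic property puts the exponent
of `x_k p` into `leadSet J`, and the absence of a gap puts `s` there. -/
theorem regularAt_tailIdeal_of_not_hasGap {J : Ideal (BiPoly K n m)} (hJ : IsBihomogeneous J)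
    {k : Fin n} {j a : ℤ} (h : ¬ HasGap (leadSet J) k j a) :
    RegularAt (tailIdeal J (k + 1)) (X (Sum.inl k)) j a := by
  have main : ∀ s : Fin n ⊕ Fin m →₀ ℕ, ∀ p ∈ biPart K n m (a, j), IsLeading p s →
      X (Sum.inl k) * p ∈ tailIdeal J (k + 1) → p ∈ tailIdeal J (k + 1) := by
    intro s
    induction s using termKey_wellFounded.induction with
    | _ s ih =>
    intro p hp hps hkp
    have hsdeg := mem_biPart_iff.1 hp s hps.1
    suffices hq : ∃ q ∈ tailIdeal J (k + 1), q ∈ biPart K n m (a, j) ∧ IsLeading q s by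
      obtain ⟨q, hq, hqa, hqs⟩ := hq
      set e : K := coeff s p / coeff s q with he
      have hqs0 : coeff s q ≠ 0 := mem_support_iff.1 hqs.1
      have hsub : p - C e * q ∈ tailIdeal J (k + 1) := by
        by_cases h0 : p - C e * q = 0
        · rw [h0]; exact zero_mem _
        obtain ⟨t, ht⟩ := exists_isLeading h0
        refine ih t ?_ _ (sub_mem hp (mul_mem_biPart (C_mem_biPart e) hqa (zero_add _))) ht ?_
        · have hts : t ≠ s := by
            rintro rfl
            apply mem_support_iff.1 ht.1
            rw [coeff_sub, coeff_C_mul, he, div_mul_cancel₀ _ hqs0, sub_self]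
          have := mem_support_iff.1 ht.1
          by_cases htp : t ∈ p.support
          · exact hps.2 t htp hts
          · refine hqs.2 t (mem_support_iff.2 fun h => this ?_) hts
            rw [coeff_sub, coeff_C_mul, h, mul_zero, notMem_support_iff.1 htp, sub_zero]
        · rw [mul_sub]
          refine sub_mem hkp (Ideal.mul_mem_left _ _ (Ideal.mul_mem_left _ _ hq))
      have := add_mem hsub (Ideal.mul_mem_left _ (C e) hq)
      simpa using this
    have hkp' : IsLeading (X (Sum.inl k) * p) (s + Finsupp.single (Sum.inl k) 1) := by
      rw [add_comm]; exact hps.monomial_mul _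
    by_cases hs : ∀ v > k, s (Sum.inl v) = 0
    · have h1 : s + Finsupp.single (Sum.inl k) 1 ∈ leadSet J := by
        refine mem_leadSet_of_mem_tailIdeal hJ hkp
          (mul_mem_biPart (X_inl_mem_biPart k) hp rfl) hkp' fun v hv => ?_
        have hkv : k < v := Fin.lt_def.2 hv
        simp [hs v hkv, hkv.ne]
      have h2 : s ∈ leadSet J := by
        by_contra h2
        exact h ⟨s, hsdeg.1, hsdeg.2, hs, h2, h1⟩
      obtain ⟨q, hq, hqd, hqs⟩ := exists_homogeneous_of_mem_leadSet hJ h2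
      refine ⟨q, Ideal.mem_sup_left hq, ?_, hqs⟩
      rwa [hsdeg.1, hsdeg.2] at hqd
    · push Not at hs
      obtain ⟨v, hv, hsv⟩ := hs
      classical
      refine ⟨monomial s 1, Ideal.mem_sup_right ?_, ?_, by simp, fun t ht hts => ?_⟩
      · rw [mem_ideal_span_X_image]
        intro t ht
        have : t = s := by simpa using support_monomial_subset ht
        exact ⟨Sum.inl v, ⟨v, hv, rfl⟩, this ▸ hsv⟩
      · exact isWeightedHomogeneous_monomial _ _ _ (by
          rw [weight_biWeight, hsdeg.1, hsdeg.2])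
      · exact absurd (by simpa using support_monomial_subset ht) hts
  intro p hp hkp
  by_cases h0 : p = 0
  · rw [h0]; exact zero_mem _
  obtain ⟨s, hs⟩ := exists_isLeading h0
  exact main s p hp hs hkp

/-- For a gap `w` take `p ∈ J` with initial monomial `w x_k`. Each term of `p` not divisible by
`x_k` contains a later variable, since otherwise it would exceed `w x_k`. So `p = x_k q` modulo the
later variables, with `w` initial in `q`; regularity would put `q` into the tail ideal and `w` into
`leadSet J`. -/
theorem not_hasGap_of_regularAt_tailIdeal {J : Ideal (BiPoly K n m)} (hJ : IsBihomogeneous J)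
    {k : Fin n} {j a : ℤ} (h : RegularAt (tailIdeal J (k + 1)) (X (Sum.inl k)) j a) :
    ¬ HasGap (leadSet J) k j a := by
  rintro ⟨w, hwa, hwj, hwk, hwB, hwB'⟩
  obtain ⟨p, hp, hpd, hpw⟩ := exists_homogeneous_of_mem_leadSet hJ hwB'
  rw [mem_biPart_iff] at hpd
  simp only [xDeg_add, yDeg_add, xDeg_single_inl, yDeg_single_inl] at hpd
  set q := p.divMonomial (Finsupp.single (Sum.inl k) 1) with hq
  have hsplit := divMonomial_add_modMonomial_single p (Sum.inl k)
  have hmod : p.modMonomial (Finsupp.single (Sum.inl k) 1) ∈ tailIdeal J (k + 1) := by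
    refine Ideal.mem_sup_right ?_
    rw [mem_ideal_span_X_image]
    intro t ht
    rw [mem_support_iff] at ht
    have htk : ¬ Finsupp.single (Sum.inl k) 1 ≤ t := fun hle =>
      ht (coeff_modMonomial_of_le p hle)
    rw [coeff_modMonomial_of_not_le p htk] at ht
    have htk' : t (Sum.inl k) = 0 := by
      rw [Finsupp.single_le_iff] at htk; omega
    by_contra hcon
    have ht0 : ∀ v > k, t (Sum.inl v) = 0 := by
      intro v hv
      by_contra h
      exact hcon ⟨Sum.inl v, ⟨v, Nat.succ_le_of_lt (Fin.lt_def.1 hv), rfl⟩, h⟩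
    have htdeg := hpd t (mem_support_iff.2 ht)
    have hne : t ≠ w + Finsupp.single (Sum.inl k) 1 := by
      rintro rfl
      simp at htk'
    have h1 := hpw.2 t (mem_support_iff.2 ht) hne
    have h2 : termKey (w + Finsupp.single (Sum.inl k) 1) < termKey t := by
      refine termKey_lt_of_inl ?_ ?_ (i := k) (fun v hv => ?_) ?_
      · rw [xDeg_add, xDeg_single_inl]; omega
      · rw [yDeg_add, yDeg_single_inl]; omega
      · simp [hwk v hv, ht0 v hv, hv.ne]
      · simp [htk']
    exact lt_asymm h1 h2
  have hXq : X (Sum.inl k) * q ∈ tailIdeal J (k + 1) := by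
    have := sub_mem (Ideal.mem_sup_left hp : p ∈ tailIdeal J (k + 1)) hmod
    rwa [← eq_sub_of_add_eq hsplit] at this
  have hqd : q ∈ biPart K n m (a, j) := by
    rw [mem_biPart_iff]
    intro t ht
    rw [mem_support_iff, hq, coeff_divMonomial] at ht
    have := hpd _ (mem_support_iff.2 ht)
    rw [xDeg_add, yDeg_add, xDeg_single_inl, yDeg_single_inl] at this
    push_cast at this
    omega
  have hqw : IsLeading q w := by
    refine ⟨?_, fun t ht htw => ?_⟩
    · rw [mem_support_iff, hq, coeff_divMonomial, add_comm]
      exact mem_support_iff.1 hpw.1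
    · rw [mem_support_iff, hq, coeff_divMonomial] at ht
      have := hpw.2 _ (mem_support_iff.2 ht) (by
        rw [add_comm w]; exact fun h => htw (add_left_cancel h))
      rw [add_comm w] at this
      exact (termKey_add_lt _).1 this
  exact hwB (mem_leadSet_of_mem_tailIdeal hJ (h q hqd hXq) hqd hqw fun v hv =>
    hwk v (Fin.lt_def.2 hv))

/-- Multiplication by `x_k` on `S / (J + (x_{k+1}, …, x_n))` in terms of the initial
monomials of `J`. -/
theorem regularAt_tailIdeal_iff {J : Ideal (BiPoly K n m)} (hJ : IsBihomogeneous J)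
    {k : Fin n} {j a : ℤ} :
    RegularAt (tailIdeal J (k + 1)) (X (Sum.inl k)) j a ↔ ¬ HasGap (leadSet J) k j a :=
  ⟨not_hasGap_of_regularAt_tailIdeal hJ, regularAt_tailIdeal_of_not_hasGap hJ⟩

end Leading

/-! ### Generic coordinates and strong stability in characteristic zero. -/

section Generic

variable (K : Type*) [Field K] (n m : ℕ)

/-- The coordinate ring of the space of pairs of matrices. -/
abbrev ParamRing : Type _ := MvPolynomial ((Fin n × Fin n) ⊕ (Fin m × Fin m)) K

/-- The polynomial ring `S` with coefficients in the coordinate ring of pairs of matrices. -/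
abbrev GenPoly : Type _ := MvPolynomial (Fin n ⊕ Fin m) (ParamRing K n m)

variable {K n m}

/-- The entries of the generic block matrix. -/
noncomputable def genEntry : Fin n ⊕ Fin m → Fin n ⊕ Fin m → ParamRing K n m
  | Sum.inl i, Sum.inl j => X (Sum.inl (i, j))
  | Sum.inr k, Sum.inr l => X (Sum.inr (k, l))
  | _, _ => 0

/-- The generic linear change of coordinates. -/
noncomputable def genAct : BiPoly K n m →ₐ[K] GenPoly K n m :=
  aeval fun b => ∑ a, C (genEntry a b) * X a

theorem genAct_X (b : Fin n ⊕ Fin m) :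
    genAct (X b : BiPoly K n m) = ∑ a, C (genEntry a b) * X a := by
  rw [genAct, aeval_X]

/-- Specialization of the generic matrices at `g`. -/
noncomputable def specializeAt (g : GL (Fin n) K × GL (Fin m) K) : GenPoly K n m →+* BiPoly K n m :=
  MvPolynomial.map (eval (biCoords g))

theorem specialize_genAct (g : GL (Fin n) K × GL (Fin m) K) (p : BiPoly K n m) :
    specializeAt g (genAct p) = biAct g p := by
  induction p using MvPolynomial.induction_on with
  | C c =>
    rw [← algebraMap_eq, AlgHom.commutes, AlgHom.commutes]
    simp [specializeAt, IsScalarTower.algebraMap_apply K (ParamRing K n m) (GenPoly K n m),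
      algebraMap_eq]
  | add p q hp hq => rw [map_add, map_add, map_add, hp, hq]
  | mul_X p b hp =>
    rw [map_mul, map_mul, map_mul, hp, genAct_X]
    congr 1
    rcases b with j | l
    · simp [specializeAt, genEntry, biAct, biCoords, Fintype.sum_sum_type]
    · simp [specializeAt, genEntry, biAct, biCoords, Fintype.sum_sum_type]

theorem specialize_mem_map {J : Ideal (BiPoly K n m)} (g : GL (Fin n) K × GL (Fin m) K)
    {F : GenPoly K n m} (hF : F ∈ J.map genAct) : specializeAt g F ∈ J.map (biAct g) := by
  have : J.map genAct ≤ (J.map (biAct g)).comap (specializeAt g) := by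
    rw [Ideal.map_le_iff_le_comap]
    intro p hp
    rw [Ideal.mem_comap, Ideal.mem_comap, specialize_genAct]
    exact Ideal.mem_map_of_mem _ hp
  exact this hF

/-- The infinitesimal left multiplication of the generic matrix by `-E_{ba}`. -/
noncomputable def paramDerivation (a b : Fin n ⊕ Fin m) :
    Derivation K (ParamRing K n m) (ParamRing K n m) :=
  mkDerivation K (Sum.elim
    (fun p => if Sum.inl p.1 = b then -genEntry a (Sum.inl p.2) else 0)
    (fun p => if Sum.inr p.1 = b then -genEntry a (Sum.inr p.2) else 0))

theorem paramDerivation_genEntry {a b : Fin n ⊕ Fin m} (h : VarLT a b) (i j : Fin n ⊕ Fin m) :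
    paramDerivation a b (genEntry (K := K) i j) = if i = b then -genEntry a j else 0 := by
  rcases i with i | i <;> rcases j with j | j
  · simp [paramDerivation, genEntry, mkDerivation_X]
  · rcases h with h | h <;> simp [genEntry]
  · rcases h with h | h <;> simp [genEntry]
  · simp [paramDerivation, genEntry, mkDerivation_X]

/-- A derivation of the coefficients together with `X_a ↦ X_b` extends to a derivation. -/
theorem exists_derivation (a b : Fin n ⊕ Fin m)
    (δ : Derivation K (ParamRing K n m) (ParamRing K n m)) :
    ∃ D : Derivation K (GenPoly K n m) (GenPoly K n m), (∀ c, D (C c) = C (δ c)) ∧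
      ∀ v, D (X v) = if v = a then X b else 0 := by
  -- Over `K` this is a polynomial ring in the coordinates and the matrix entries together, so a
  -- derivation may be prescribed freely on both.
  let e := sumAlgEquiv K (Fin n ⊕ Fin m) ((Fin n × Fin n) ⊕ (Fin m × Fin m))
  let D' : Derivation K (MvPolynomial ((Fin n ⊕ Fin m) ⊕ ((Fin n × Fin n) ⊕ (Fin m × Fin m))) K)
      (MvPolynomial ((Fin n ⊕ Fin m) ⊕ ((Fin n × Fin n) ⊕ (Fin m × Fin m))) K) :=
    mkDerivation K (Sum.elim (fun v => if v = a then X (Sum.inl b) else 0)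
      (fun p => e.symm (C (δ (X p)))))
  let D : Derivation K (GenPoly K n m) (GenPoly K n m) :=
    Derivation.mk' (e.toLinearMap ∘ₗ D'.toLinearMap ∘ₗ e.symm.toLinearMap) (by
      intro p q
      simp)
  have hD : ∀ p, D p = e (D' (e.symm p)) := fun p => rfl
  have hX : ∀ v, D (X v) = if v = a then X b else 0 := by
    intro v
    rw [hD, show e.symm (X v) = X (Sum.inl v) from sumAlgEquiv_symm_X _ _ _ _, mkDerivation_X]
    simp only [Sum.elim_inl]
    split_ifs
    · exact sumAlgEquiv_X_inl _ _ _ _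
    · exact map_zero _
  refine ⟨D, fun c => ?_, hX⟩
  induction c using MvPolynomial.induction_on with
  | C c =>
    have : (C (C c) : GenPoly K n m) = algebraMap K _ c := rfl
    have this' : (C c : ParamRing K n m) = algebraMap K _ c := rfl
    rw [this, this', Derivation.map_algebraMap, Derivation.map_algebraMap, map_zero]
  | add p q hp hq => simp only [map_add, hp, hq]
  | mul_X p v hp =>
    have : D (C (X v)) = C (δ (X v)) := by
      rw [hD, show e.symm (C (X v)) = X (Sum.inr v) from sumAlgEquiv_symm_C_X _ _ _ _,
        mkDerivation_X, Sum.elim_inr, AlgEquiv.apply_symm_apply]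
    rw [map_mul, Derivation.leibniz, Derivation.leibniz, hp, this]
    simp

theorem derivation_monomial_one {a b : Fin n ⊕ Fin m}
    {D : Derivation K (GenPoly K n m) (GenPoly K n m)}
    (hX : ∀ v, D (X v) = if v = a then X b else 0) (t : Fin n ⊕ Fin m →₀ ℕ) :
    D (monomial t 1) =
      monomial (t - Finsupp.single a 1 + Finsupp.single b 1) (t a : ParamRing K n m) := by
  classical
  induction t using Finsupp.induction_linear with
  | zero =>
    have : (monomial 0 1 : GenPoly K n m) = 1 := rfl
    simp [this]
  | add f g hf hg =>
    have aux : ∀ f g : Fin n ⊕ Fin m →₀ ℕ, (monomial f 1 : GenPoly K n m) *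
        monomial (g - Finsupp.single a 1 + Finsupp.single b 1) (g a : ParamRing K n m) =
        monomial (f + g - Finsupp.single a 1 + Finsupp.single b 1) (g a : ParamRing K n m) := by
      intro f g
      rw [monomial_mul, one_mul]
      by_cases hga : g a = 0
      · simp [hga]
      · congr 2
        rw [← add_assoc, add_tsub_assoc_of_le]
        rw [Finsupp.single_le_iff]; omega
    have h : (monomial (f + g) 1 : GenPoly K n m) = monomial f 1 * monomial g 1 := by
      rw [monomial_mul, one_mul]
    rw [h, Derivation.leibniz, hf, hg, smul_eq_mul, smul_eq_mul, aux, aux, add_comm g f, ← map_add,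
      Finsupp.add_apply, Nat.cast_add, add_comm (g a : ParamRing K n m)]
  | single v k =>
    rw [← X_pow_eq_monomial, Derivation.leibniz_pow, hX]
    by_cases hv : v = a
    · subst hv
      rw [if_pos rfl, Finsupp.single_eq_same, ← Finsupp.single_tsub, X_pow_eq_monomial, X,
        smul_eq_mul, monomial_mul, one_mul, ← map_nsmul, nsmul_one]
    · rw [if_neg hv, Finsupp.single_eq_of_ne (Ne.symm hv)]
      simp

theorem derivation_monomial {a b : Fin n ⊕ Fin m}
    {δ : Derivation K (ParamRing K n m) (ParamRing K n m)}
    {D : Derivation K (GenPoly K n m) (GenPoly K n m)} (hC : ∀ c, D (C c) = C (δ c))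
    (hX : ∀ v, D (X v) = if v = a then X b else 0) (t : Fin n ⊕ Fin m →₀ ℕ)
    (c : ParamRing K n m) :
    D (monomial t c) = monomial t (δ c) +
      monomial (t - Finsupp.single a 1 + Finsupp.single b 1) (c * t a) := by
  have : (monomial t c : GenPoly K n m) = C c * monomial t 1 := by
    rw [C_mul_monomial, mul_one]
  rw [this, Derivation.leibniz, hC, derivation_monomial_one hX, smul_eq_mul, smul_eq_mul,
    C_mul_monomial, mul_comm (monomial t 1), C_mul_monomial, mul_one, add_comm]

/-- On `∑ A_{iv} X_i` the substitution `X_a ↦ X_b` contributes `A_{av} X_b`, and the coefficient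
derivation, taking `A_{bv}` to `-A_{av}`, cancels it. Hence the ideal in generic coordinates is
stable under `D`. -/
theorem derivation_genAct {a b : Fin n ⊕ Fin m} (h : VarLT a b)
    {D : Derivation K (GenPoly K n m) (GenPoly K n m)}
    (hC : ∀ c, D (C c) = C (paramDerivation a b c))
    (hX : ∀ v, D (X v) = if v = a then X b else 0) (p : BiPoly K n m) : D (genAct p) = 0 := by
  induction p using MvPolynomial.induction_on with
  | C c => rw [← algebraMap_eq, AlgHom.commutes, Derivation.map_algebraMap]
  | add p q hp hq => rw [map_add, map_add, hp, hq, add_zero]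
  | mul_X p v hp =>
    have : D (genAct (X v)) = 0 := by
      rw [genAct_X, map_sum]
      simp only [Derivation.leibniz, hC, hX, paramDerivation_genEntry h, smul_eq_mul,
        Finset.sum_add_distrib]
      rw [Finset.sum_eq_single a (fun w _ hw => by rw [if_neg hw, mul_zero])
          (fun h => absurd (Finset.mem_univ a) h),
        Finset.sum_eq_single b (fun w _ hw => by rw [if_neg hw, map_zero, mul_zero])
          (fun h => absurd (Finset.mem_univ b) h), if_pos rfl, if_pos rfl, map_neg]
      ring
    rw [map_mul, Derivation.leibniz, hp, this, smul_zero, smul_zero, add_zero]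

theorem derivation_mem_map {a b : Fin n ⊕ Fin m} (h : VarLT a b)
    {D : Derivation K (GenPoly K n m) (GenPoly K n m)}
    (hC : ∀ c, D (C c) = C (paramDerivation a b c))
    (hX : ∀ v, D (X v) = if v = a then X b else 0) {J : Ideal (BiPoly K n m)}
    {F : GenPoly K n m} (hF : F ∈ J.map genAct) : D F ∈ J.map genAct := by
  refine Submodule.span_induction (p := fun F _ => D F ∈ J.map genAct) ?_ ?_ ?_ ?_ hF
  · rintro _ ⟨p, -, rfl⟩
    rw [derivation_genAct h hC hX]
    exact zero_mem _
  · rw [map_zero]; exact zero_mem _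
  · intro p q _ _ hp hq
    rw [map_add]; exact add_mem hp hq
  · intro r p hp hDp
    rw [smul_eq_mul, Derivation.leibniz]
    exact add_mem (Ideal.mul_mem_left _ _ hDp) (Ideal.mul_mem_right _ _ hp)

theorem VarLT.termKey_exchange_lt {a b : Fin n ⊕ Fin m} (h : VarLT a b)
    {s : Fin n ⊕ Fin m →₀ ℕ} (hs : s a ≠ 0) :
    termKey s < termKey (s - Finsupp.single a 1 + Finsupp.single b 1) := by
  have hle : Finsupp.single a 1 ≤ s := by rw [Finsupp.single_le_iff]; omega
  nth_rw 1 [← tsub_add_cancel_of_le hle]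
  exact (termKey_add_lt _).2 h.termKey_single_lt

theorem termKey_exchange_lt_exchange {a b : Fin n ⊕ Fin m} {s t : Fin n ⊕ Fin m →₀ ℕ}
    (ht : t a ≠ 0) (hs : s a ≠ 0) (h : termKey t < termKey s) :
    termKey (t - Finsupp.single a 1 + Finsupp.single b 1) <
      termKey (s - Finsupp.single a 1 + Finsupp.single b 1) := by
  have hle : Finsupp.single a 1 ≤ s := by rw [Finsupp.single_le_iff]; omega
  have hle' : Finsupp.single a 1 ≤ t := by rw [Finsupp.single_le_iff]; omega
  rw [← tsub_add_cancel_of_le hle, ← tsub_add_cancel_of_le hle', add_comm _ (Finsupp.single a 1),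
    add_comm _ (Finsupp.single a 1), termKey_add_lt] at h
  rw [add_comm _ (Finsupp.single b 1), add_comm _ (Finsupp.single b 1), termKey_add_lt]
  exact h

/-- In characteristic zero the exponents of the generic initial monomials are strongly stable in
both groups of variables. -/
theorem exchange_mem_leadSet_map_genAct [CharZero K] {J : Ideal (BiPoly K n m)}
    {a b : Fin n ⊕ Fin m} (h : VarLT a b) {s : Fin n ⊕ Fin m →₀ ℕ}
    (hs : s ∈ leadSet (J.map genAct)) (hsa : s a ≠ 0) :
    s - Finsupp.single a 1 + Finsupp.single b 1 ∈ leadSet (J.map genAct) := by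
  classical
  obtain ⟨F, hF, hFs⟩ := hs
  -- `D F` lies in the generic ideal. Differentiated coefficients contribute only exponents up to
  -- `s`; each exponent `t` also contributes its exchange, multiplied by `t a`. As `b` is the larger
  -- variable, the exchange of `s` lies strictly above all else, and its coefficient has the factor
  -- `s a`, nonzero in characteristic zero.
  obtain ⟨D, hC, hX⟩ := exists_derivation a b (paramDerivation (K := K) a b)
  set ex : (Fin n ⊕ Fin m →₀ ℕ) → (Fin n ⊕ Fin m →₀ ℕ) := fun t =>
    t - Finsupp.single a 1 + Finsupp.single b 1 with hex
  have hcoeff : ∀ r, coeff r (D F) = coeff r (monomial r (paramDerivation a b (coeff r F))) +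
      ∑ t ∈ F.support, if ex t = r then coeff t F * (t a : ParamRing K n m) else 0 := by
    intro r
    conv_lhs => rw [F.as_sum, map_sum]
    simp only [derivation_monomial hC hX, coeff_sum, coeff_add, coeff_monomial,
      Finset.sum_add_distrib]
    congr 1
    rw [Finset.sum_ite_eq' F.support r]
    simp only [if_true]
    split_ifs with hr
    · rfl
    · rw [notMem_support_iff.1 hr, map_zero]
  have hss : termKey s < termKey (ex s) := h.termKey_exchange_lt hsa
  have hle : ∀ t ∈ F.support, termKey t ≤ termKey s := fun t ht => by
    by_cases hts : t = s
    · rw [hts]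
    · exact (hFs.2 t ht hts).le
  have hne : ∀ t ∈ F.support, t a ≠ 0 → t ≠ s → termKey (ex t) < termKey (ex s) :=
    fun t ht hta hts => termKey_exchange_lt_exchange hta hsa (hFs.2 t ht hts)
  refine ⟨D F, derivation_mem_map h hC hX hF, ?_, fun r hr hrs => ?_⟩
  · have h0 : coeff (ex s) F = 0 := by
      by_contra h0
      exact absurd (hle _ (mem_support_iff.2 h0)) (not_le.2 hss)
    rw [mem_support_iff, hcoeff, h0, map_zero, map_zero, coeff_zero, zero_add,
      Finset.sum_eq_single s]
    · rw [if_pos rfl]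
      exact mul_ne_zero (mem_support_iff.1 hFs.1) (Nat.cast_ne_zero.2 hsa)
    · intro t ht hts
      by_cases hta : t a = 0
      · simp [hta]
      · rw [if_neg]
        intro heq
        exact (hne t ht hta hts).ne (by rw [heq])
    · intro hs; exact absurd hFs.1 hs
  · by_cases hrF : r ∈ F.support
    · exact (hle r hrF).trans_lt hss
    · rw [mem_support_iff, hcoeff, notMem_support_iff.1 hrF, map_zero, map_zero, coeff_zero,
        zero_add] at hr
      obtain ⟨t, ht, ht'⟩ := Finset.exists_ne_zero_of_sum_ne_zero hr
      rw [ite_ne_right_iff] at ht'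
      obtain ⟨rfl, ht'⟩ := ht'
      have hta : t a ≠ 0 := fun h0 => ht' (by simp [h0])
      exact hne t ht hta fun hts => hrs (by rw [hts])

end Generic

/-! ### The group action. -/

section BiAct

variable {K : Type*} [Field K] {n m : ℕ}

theorem biAct_X_inl (g : GL (Fin n) K × GL (Fin m) K) (j : Fin n) :
    biAct g (X (Sum.inl j)) = ∑ i, C (g.1.1 i j) * X (Sum.inl i) := by
  simp [biAct]

theorem biAct_X_inr (g : GL (Fin n) K × GL (Fin m) K) (l : Fin m) :
    biAct g (X (Sum.inr l)) = ∑ k, C (g.2.1 k l) * X (Sum.inr k) := by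
  simp [biAct]

theorem biAct_biAct (g h : GL (Fin n) K × GL (Fin m) K) (p : BiPoly K n m) :
    biAct g (biAct h p) = biAct (g * h) p := by
  have : (biAct g).comp (biAct h) = biAct (g * h) := by
    refine MvPolynomial.algHom_ext fun v => ?_
    rw [AlgHom.comp_apply]
    have hC : ∀ c : K, biAct g (C c) = C c := fun c => by
      rw [← algebraMap_eq, AlgHom.commutes]
    rcases v with j | l
    · rw [biAct_X_inl, biAct_X_inl, map_sum]
      simp only [map_mul, hC, biAct_X_inl, Prod.fst_mul, Units.val_mul, Matrix.mul_apply,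
        map_sum, Finset.mul_sum, Finset.sum_mul]
      rw [Finset.sum_comm]
      exact Finset.sum_congr rfl fun i _ => Finset.sum_congr rfl fun k _ => by ring
    · rw [biAct_X_inr, biAct_X_inr, map_sum]
      simp only [map_mul, hC, biAct_X_inr, Prod.snd_mul, Units.val_mul, Matrix.mul_apply,
        map_sum, Finset.mul_sum, Finset.sum_mul]
      rw [Finset.sum_comm]
      exact Finset.sum_congr rfl fun i _ => Finset.sum_congr rfl fun k _ => by ring
  rw [← this, AlgHom.comp_apply]

theorem biAct_one (p : BiPoly K n m) : biAct 1 p = p := by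
  have : biAct (1 : GL (Fin n) K × GL (Fin m) K) = AlgHom.id K (BiPoly K n m) := by
    refine MvPolynomial.algHom_ext fun v => ?_
    rcases v with j | l
    · rw [biAct_X_inl]; simp [Matrix.one_apply]
    · rw [biAct_X_inr]; simp [Matrix.one_apply]
  rw [this, AlgHom.id_apply]

theorem biAct_inv_biAct (g : GL (Fin n) K × GL (Fin m) K) (p : BiPoly K n m) :
    biAct g⁻¹ (biAct g p) = p := by
  rw [biAct_biAct, inv_mul_cancel, biAct_one]

theorem biAct_biAct_inv (g : GL (Fin n) K × GL (Fin m) K) (p : BiPoly K n m) :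
    biAct g (biAct g⁻¹ p) = p := by
  rw [biAct_biAct, mul_inv_cancel, biAct_one]

theorem biAct_injective (g : GL (Fin n) K × GL (Fin m) K) : Function.Injective (biAct g) :=
  Function.LeftInverse.injective (biAct_inv_biAct g)

theorem biAct_surjective (g : GL (Fin n) K × GL (Fin m) K) : Function.Surjective (biAct g) :=
  Function.RightInverse.surjective (biAct_biAct_inv g)

theorem mem_map_biAct_iff {J : Ideal (BiPoly K n m)} {g : GL (Fin n) K × GL (Fin m) K}
    {p : BiPoly K n m} : p ∈ J.map (biAct g) ↔ ∃ q ∈ J, biAct g q = p :=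
  Ideal.mem_map_iff_of_surjective _ (biAct_surjective g)

end BiAct

/-! ### Total degree under linear substitutions, and independence through initial monomials. -/

section Degree

theorem totalDegree_algHom_le {σ τ K A : Type*} [CommRing K] [CommRing A] [Algebra K A]
    (φ : MvPolynomial σ K →ₐ[K] MvPolynomial τ A) (hφ : ∀ v, (φ (X v)).totalDegree ≤ 1)
    (p : MvPolynomial σ K) : (φ p).totalDegree ≤ p.totalDegree := by
  conv_lhs => rw [p.as_sum, map_sum]
  refine totalDegree_finsetSum_le fun s hs => ?_
  rw [monomial_eq, map_mul, ← algebraMap_eq, AlgHom.commutes, Finsupp.prod, map_prod]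
  have h1 : (algebraMap K (MvPolynomial τ A) (coeff s p)).totalDegree = 0 := by
    rw [IsScalarTower.algebraMap_apply K A (MvPolynomial τ A), algebraMap_eq, totalDegree_C]
  refine (totalDegree_mul _ _).trans ?_
  rw [h1, zero_add]
  refine (totalDegree_finsetProd _ _).trans (le_trans ?_ (le_totalDegree hs))
  refine Finset.sum_le_sum fun v _ => ?_
  rw [map_pow]
  exact (totalDegree_pow _ _).trans (by simpa using Nat.mul_le_mul_left (s v) (hφ v))

variable {n m : ℕ} {R : Type*} [CommRing R]

theorem sum_eq_xDeg_add_yDeg (s : Fin n ⊕ Fin m →₀ ℕ) :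
    (s.sum fun _ e => e) = xDeg s + yDeg s := by
  rw [Finsupp.sum_fintype _ _ (fun _ => rfl), Fintype.sum_sum_type]; rfl

theorem IsLeading.totalDegree_eq {p : MvPolynomial (Fin n ⊕ Fin m) R}
    {s : Fin n ⊕ Fin m →₀ ℕ} (h : IsLeading p s) : p.totalDegree = xDeg s + yDeg s := by
  refine le_antisymm ?_ ?_
  · refine Finset.sup_le fun t ht => ?_
    rw [sum_eq_xDeg_add_yDeg]
    by_cases hts : t = s
    · rw [hts]
    · exact deg_le_of_termKey_lt (h.2 t ht hts)
  · rw [← sum_eq_xDeg_add_yDeg]; exact le_totalDegree h.1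

variable {K : Type*} [Field K]

theorem totalDegree_C_mul_X_le {σ : Type*} (c : R) (v : σ) :
    (C c * X v : MvPolynomial σ R).totalDegree ≤ 1 := by
  rw [C_mul_X_eq_monomial]
  exact (totalDegree_monomial_le _ _).trans (by simp)

theorem totalDegree_biAct_le (g : GL (Fin n) K × GL (Fin m) K) (p : BiPoly K n m) :
    (biAct g p).totalDegree ≤ p.totalDegree := by
  refine totalDegree_algHom_le _ (fun v => ?_) p
  rcases v with j | l
  · rw [biAct_X_inl]; exact totalDegree_finsetSum_le fun i _ => totalDegree_C_mul_X_le _ _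
  · rw [biAct_X_inr]; exact totalDegree_finsetSum_le fun i _ => totalDegree_C_mul_X_le _ _

theorem totalDegree_genAct_le (p : BiPoly K n m) : (genAct p).totalDegree ≤ p.totalDegree := by
  refine totalDegree_algHom_le _ (fun v => ?_) p
  rw [genAct_X]
  exact totalDegree_finsetSum_le fun i _ => totalDegree_C_mul_X_le _ _

/-- At the largest `t` with `b t ≠ 0` no other summand contributes to the coefficient. -/
theorem eq_zero_of_sum_smul_eq_zero {T : Finset (Fin n ⊕ Fin m →₀ ℕ)}
    {q : (Fin n ⊕ Fin m →₀ ℕ) → BiPoly K n m} (hq : ∀ t ∈ T, IsLeading (q t) t)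
    {b : (Fin n ⊕ Fin m →₀ ℕ) → K} (h : ∑ t ∈ T, C (b t) * q t = 0) : ∀ t ∈ T, b t = 0 := by
  classical
  by_contra hcon
  push Not at hcon
  obtain ⟨t₁, ht₁, hb₁⟩ := hcon
  obtain ⟨t₀, ht₀, hmax⟩ := Finset.exists_max_image (T.filter fun t => b t ≠ 0) termKey
    ⟨t₁, by simp [ht₁, hb₁]⟩
  rw [Finset.mem_filter] at ht₀
  have := congrArg (coeff t₀) h
  rw [coeff_sum, Finset.sum_eq_single t₀, coeff_C_mul, coeff_zero] at this
  · exact (mul_ne_zero ht₀.2 (mem_support_iff.1 (hq t₀ ht₀.1).1)) this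
  · intro t ht htt
    rw [coeff_C_mul]
    by_cases hbt : b t = 0
    · rw [hbt, zero_mul]
    · have h1 := hmax t (Finset.mem_filter.2 ⟨ht, hbt⟩)
      have : coeff t₀ (q t) = 0 := by
        by_contra h0
        exact absurd ((hq t ht).2 t₀ (mem_support_iff.2 h0) (Ne.symm htt)) (not_lt.2 h1)
      rw [this, mul_zero]
  · intro h; exact absurd ht₀.1 h

end Degree

/-! ### Existence of the bigeneric initial ideal. -/

section Bigin

variable {K : Type*} [Field K] {n m : ℕ}

/-- Multiplying `q` by both generic determinants forces a point of non-vanishing to be a pair of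
invertible matrices. -/
theorem exists_eval_biCoords_ne_zero [Infinite K] {q : ParamRing K n m} (hq : q ≠ 0) :
    ∃ g : GL (Fin n) K × GL (Fin m) K, eval (biCoords g) q ≠ 0 := by
  set A : Matrix (Fin n) (Fin n) (ParamRing K n m) := Matrix.of fun i j => X (Sum.inl (i, j))
    with hA
  set A' : Matrix (Fin m) (Fin m) (ParamRing K n m) := Matrix.of fun i j => X (Sum.inr (i, j))
    with hA'
  have evA : ∀ x : (Fin n × Fin n) ⊕ (Fin m × Fin m) → K,
      eval x A.det = (Matrix.of fun i j => x (Sum.inl (i, j))).det := by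
    intro x; rw [RingHom.map_det]; congr 1; ext i j; simp [hA]
  have evA' : ∀ x : (Fin n × Fin n) ⊕ (Fin m × Fin m) → K,
      eval x A'.det = (Matrix.of fun i j => x (Sum.inr (i, j))).det := by
    intro x; rw [RingHom.map_det]; congr 1; ext i j; simp [hA']
  have hdet : A.det ≠ 0 := by
    intro h
    have := evA (Sum.elim (fun p => (1 : Matrix (Fin n) (Fin n) K) p.1 p.2) fun _ => 0)
    rw [h, map_zero] at this
    simp only [Sum.elim_inl] at this
    exact zero_ne_one (this.trans (Matrix.det_one (n := Fin n) (R := K)))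
  have hdet' : A'.det ≠ 0 := by
    intro h
    have := evA' (Sum.elim (fun _ => 0) fun p => (1 : Matrix (Fin m) (Fin m) K) p.1 p.2)
    rw [h, map_zero] at this
    simp only [Sum.elim_inr] at this
    exact zero_ne_one (this.trans (Matrix.det_one (n := Fin m) (R := K)))
  obtain ⟨x, hx⟩ : ∃ x, eval x (q * (A.det * A'.det)) ≠ 0 := by
    by_contra hcon
    push Not at hcon
    exact mul_ne_zero hq (mul_ne_zero hdet hdet')
      (MvPolynomial.funext fun x => by rw [hcon x, map_zero])
  rw [map_mul, map_mul, evA, evA'] at hx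
  refine ⟨(Matrix.GeneralLinearGroup.mkOfDetNeZero _ (left_ne_zero_of_mul (right_ne_zero_of_mul hx)),
    Matrix.GeneralLinearGroup.mkOfDetNeZero _ (right_ne_zero_of_mul (right_ne_zero_of_mul hx))), ?_⟩
  convert left_ne_zero_of_mul hx using 3
  funext v
  rcases v with v | v <;> rfl

/-- The minimal elements of a set of exponents. -/
def minExps (B : Set (Fin n ⊕ Fin m →₀ ℕ)) : Set (Fin n ⊕ Fin m →₀ ℕ) :=
  {s | s ∈ B ∧ ∀ t ≤ s, t ∈ B → t = s}

theorem finite_minExps (B : Set (Fin n ⊕ Fin m →₀ ℕ)) : (minExps B).Finite := by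
  refine IsAntichain.finite_of_partiallyWellOrderedOn (r := (· ≤ ·)) ?_ (Set.isPWO_of_wellQuasiOrderedLE _)
  intro s hs t ht hst hle
  exact hst (ht.2 s hle hs.1)

theorem exists_minExps_le {B : Set (Fin n ⊕ Fin m →₀ ℕ)} {s : Fin n ⊕ Fin m →₀ ℕ} (hs : s ∈ B) :
    ∃ t ∈ minExps B, t ≤ s := by
  obtain ⟨t, ht, hmin⟩ := WellFounded.has_min (wellFounded_lt (α := Fin n ⊕ Fin m →₀ ℕ))
    {t | t ∈ B ∧ t ≤ s} ⟨s, hs, le_rfl⟩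
  refine ⟨t, ⟨ht.1, fun u hu huB => ?_⟩, ht.2⟩
  by_contra hne
  exact hmin u ⟨huB, hu.trans ht.2⟩ (lt_of_le_of_ne hu hne)

theorem IsLeading.specializeAt {F : GenPoly K n m} {s : Fin n ⊕ Fin m →₀ ℕ} (h : IsLeading F s)
    {g : GL (Fin n) K × GL (Fin m) K} (hg : eval (biCoords g) (coeff s F) ≠ 0) :
    IsLeading (_root_.specializeAt g F) s := by
  refine ⟨?_, fun t ht hts => h.2 t ?_ hts⟩
  · rw [mem_support_iff, _root_.specializeAt, coeff_map]; exact hg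
  · rw [mem_support_iff, _root_.specializeAt, coeff_map] at ht
    rw [mem_support_iff]
    exact fun h0 => ht (by rw [h0, map_zero])

/-- For `g` in a non-empty open set, `gJ` has all generic initial monomials. -/
theorem exists_forall_leadSet_subset (J : Ideal (BiPoly K n m)) :
    ∃ c : ParamRing K n m, c ≠ 0 ∧ ∀ g : GL (Fin n) K × GL (Fin m) K, eval (biCoords g) c ≠ 0 →
      leadSet (J.map genAct) ⊆ leadSet (J.map (biAct g)) := by
  classical
  have h : ∀ s : minExps (leadSet (J.map (genAct (K := K) (n := n) (m := m)))),
      ∃ F ∈ J.map genAct, IsLeading F s.1 := fun s => s.2.1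
  choose F hF hFs using h
  have := (finite_minExps (leadSet (J.map (genAct (K := K) (n := n) (m := m))))).fintype
  -- The set of minimal exponents is finite by Dickson's lemma; where the product of one leading
  -- coefficient for each does not vanish, all these initial monomials survive specialization.
  refine ⟨∏ s, coeff s.1 (F s), Finset.prod_ne_zero_iff.2 fun s _ =>
    mem_support_iff.1 (hFs s).1, fun g hg t ht => ?_⟩
  obtain ⟨s, hs, hst⟩ := exists_minExps_le ht
  rw [map_prod, Finset.prod_ne_zero_iff] at hg
  exact leadSet_mono_le ⟨_, specialize_mem_map g (hF ⟨s, hs⟩),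
    (hFs ⟨s, hs⟩).specializeAt (hg ⟨s, hs⟩ (Finset.mem_univ _))⟩ hst

/-- A dimension count in degrees at most `k`. If `gJ` had more initial exponents (`T`) than the
generic ideal (`W`), the generic transforms of polynomials `p_t ∈ J` realizing `T` would have a
nontrivial combination `F` with zero coefficients on `W`. The initial exponent of `F` would lie in
`W`, so `F = 0`. Specializing where a coefficient of this relation survives gives a linear relation
among the `p_t`, but their transforms under `g` have distinct initial exponents. -/
theorem leadSet_eq_of_subset [Infinite K] {J : Ideal (BiPoly K n m)}
    {g : GL (Fin n) K × GL (Fin m) K}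
    (hg : leadSet (J.map genAct) ⊆ leadSet (J.map (biAct g))) :
    leadSet (J.map (biAct g)) = leadSet (J.map genAct) := by
  classical
  refine Set.Subset.antisymm (fun s hs => ?_) hg
  by_contra hsB
  set k := xDeg s + yDeg s with hk
  set Λ := (finite_setOf_deg_le (n := n) (m := m) k).toFinset with hΛ
  have memΛ : ∀ t, t ∈ Λ ↔ xDeg t + yDeg t ≤ k := fun t => by simp [hΛ]
  set T := Λ.filter (· ∈ leadSet (J.map (biAct g))) with hT
  set W := Λ.filter (· ∈ leadSet (J.map (genAct (K := K) (n := n) (m := m)))) with hW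
  have hWT : W.card < T.card := by
    refine Finset.card_lt_card ⟨fun t ht => ?_, fun h => ?_⟩
    · rw [hW, Finset.mem_filter] at ht
      exact Finset.mem_filter.2 ⟨ht.1, hg ht.2⟩
    · have hsT : s ∈ T := Finset.mem_filter.2 ⟨(memΛ s).2 le_rfl, hs⟩
      exact hsB (Finset.mem_filter.1 (h hsT)).2
  have hex : ∀ t, ∃ p : BiPoly K n m, t ∈ T → p ∈ J ∧ IsLeading (biAct g p) t ∧
      p.totalDegree ≤ k := by
    intro t
    by_cases ht : t ∈ T
    · obtain ⟨q, hq, hqt⟩ := (Finset.mem_filter.1 ht).2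
      obtain ⟨p, hp, rfl⟩ := mem_map_biAct_iff.1 hq
      refine ⟨p, fun _ => ⟨hp, hqt, ?_⟩⟩
      rw [← biAct_inv_biAct g p]
      refine (totalDegree_biAct_le _ _).trans ?_
      rw [hqt.totalDegree_eq]
      exact (memΛ t).1 (Finset.mem_filter.1 ht).1
    · exact ⟨0, fun h => absurd h ht⟩
  choose p hp using hex
  let Φ : (T → ParamRing K n m) →ₗ[ParamRing K n m] (W → ParamRing K n m) :=
    LinearMap.pi fun w => ∑ t : T, coeff w.1 (genAct (p t.1)) • LinearMap.proj t
  have hΦ : ¬ Function.Injective Φ := fun hinj => by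
    have := card_le_of_injective _ Φ hinj
    rw [Fintype.card_coe, Fintype.card_coe] at this
    omega
  obtain ⟨a, ha, ha0⟩ : ∃ a, Φ a = 0 ∧ a ≠ 0 := by
    by_contra hcon
    push Not at hcon
    exact hΦ ((injective_iff_map_eq_zero Φ).2 hcon)
  set F : GenPoly K n m := ∑ t : T, C (a t) * genAct (p t.1) with hF
  have hFJ : F ∈ J.map genAct := sum_mem fun t _ =>
    Ideal.mul_mem_left _ _ (Ideal.mem_map_of_mem _ (hp t.1 t.2).1)
  have hFdeg : F.totalDegree ≤ k := by
    refine totalDegree_finsetSum_le fun t _ => (totalDegree_mul _ _).trans ?_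
    rw [totalDegree_C, zero_add]
    exact (totalDegree_genAct_le _).trans (hp t.1 t.2).2.2
  have hF0 : F = 0 := by
    by_contra hF0
    obtain ⟨w, hw⟩ := exists_isLeading hF0
    have hwW : w ∈ W := Finset.mem_filter.2
      ⟨(memΛ w).2 (by rw [← hw.totalDegree_eq]; exact hFdeg), F, hFJ, hw⟩
    apply mem_support_iff.1 hw.1
    have := congrFun ha ⟨w, hwW⟩
    simp only [Φ, LinearMap.pi_apply, LinearMap.sum_apply, LinearMap.smul_apply,
      LinearMap.proj_apply, smul_eq_mul, Pi.zero_apply] at this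
    rw [hF, coeff_sum, ← this]
    exact Finset.sum_congr rfl fun t _ => by rw [coeff_C_mul, mul_comm]
  obtain ⟨t₀, ht₀⟩ := Function.ne_iff.1 ha0
  obtain ⟨h, hh⟩ := exists_eval_biCoords_ne_zero ht₀
  set b : (Fin n ⊕ Fin m →₀ ℕ) → K := fun t =>
    if ht : t ∈ T then eval (biCoords h) (a ⟨t, ht⟩) else 0 with hb
  have hsum : ∑ t ∈ T, C (b t) * p t = 0 := by
    apply biAct_injective h
    rw [map_zero, map_sum, ← Finset.sum_coe_sort T]
    have := congrArg (specializeAt h) hF0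
    rw [map_zero, hF, map_sum] at this
    rw [← this]
    refine Finset.sum_congr rfl fun t _ => ?_
    rw [map_mul, map_mul, specialize_genAct, ← algebraMap_eq, AlgHom.commutes]
    congr 1
    simp [specializeAt, hb, algebraMap_eq]
  have hzero := eq_zero_of_sum_smul_eq_zero (T := T) (q := fun t => biAct g (p t)) (b := b)
    (fun t ht => (hp t ht).2.1) (by
      have := congrArg (biAct g) hsum
      rw [map_zero, map_sum] at this
      rw [← this]
      refine Finset.sum_congr rfl fun t _ => ?_
      rw [map_mul, ← algebraMap_eq, AlgHom.commutes])
  have := hzero t₀.1 t₀.2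
  simp only [hb, t₀.2, dif_pos] at this
  exact hh this

/-- The bigeneric initial ideal is an initial ideal in generic coordinates, and its monomials are
the generic initial monomials. -/
theorem exists_initialIdeal_eq_bigin [Infinite K] (J : Ideal (BiPoly K n m)) :
    ∃ g : GL (Fin n) K × GL (Fin m) K, initialIdeal (J.map (biAct g)) = bigin J ∧
      leadSet (J.map (biAct g)) = leadSet (J.map genAct) := by
  obtain ⟨c, hc, hcg⟩ := exists_forall_leadSet_subset J
  have hex : ∃ B, IsBigin J B := by
    refine ⟨Ideal.span ((fun s => monomial s (1 : K)) '' leadSet (J.map genAct)),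
      {g | ∃ p ∈ ({c} : Set (ParamRing K n m)), eval (biCoords g) p ≠ 0}, ?_, ⟨_, rfl⟩, ?_⟩
    · obtain ⟨g, hg⟩ := exists_eval_biCoords_ne_zero hc
      exact ⟨g, c, rfl, hg⟩
    · rintro g ⟨_, rfl, hg⟩
      rw [initialIdeal_eq_span, leadSet_eq_of_subset (hcg g hg)]
  have hB : bigin J = hex.choose := by rw [bigin, dif_pos hex]
  obtain ⟨U, ⟨g', hg'⟩, ⟨E, rfl⟩, hU⟩ := hex.choose_spec
  obtain ⟨q, hqE, hq⟩ := hg'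
  have hq0 : q ≠ 0 := fun h => hq (by rw [h, map_zero])
  -- The coordinate ring is a domain, so the open set on which the chosen ideal is initial meets the
  -- locus `c ≠ 0`. Whichever ideal the definition chose, its monomials are the generic ones.
  obtain ⟨g, hg⟩ := exists_eval_biCoords_ne_zero (mul_ne_zero hc hq0)
  rw [map_mul] at hg
  exact ⟨g, by rw [hB]; exact hU g ⟨q, hqE, right_ne_zero_of_mul hg⟩,
    leadSet_eq_of_subset (hcg g (left_ne_zero_of_mul hg))⟩

end Bigin

/-! ### Gaps of strongly stable sets of monomials. -/

section Stable

variable {n m : ℕ} {B : Set (Fin n ⊕ Fin m →₀ ℕ)}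

/-- Strong stability with respect to both groups of variables. -/
def IsBistable (B : Set (Fin n ⊕ Fin m →₀ ℕ)) : Prop :=
  ∀ a b : Fin n ⊕ Fin m, VarLT a b → ∀ s ∈ B, s a ≠ 0 →
    s - Finsupp.single a 1 + Finsupp.single b 1 ∈ B

theorem le_of_le_add_single {a : Fin n ⊕ Fin m} {t w : Fin n ⊕ Fin m →₀ ℕ}
    (h : t ≤ w + Finsupp.single a 1) (ha : t a ≤ w a) : t ≤ w := by
  intro v
  by_cases hv : v = a
  · rw [hv]; exact ha
  · simpa [Finsupp.single_apply, Ne.symm hv] using h v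

/-- Either `t` divides `w`, or it has exactly one `a` too many; traded for a `b`, of which `w` has
one to spare, this gives an element of `B` dividing `w`. -/
theorem IsBistable.mem_of_le_add_single (hB : IsUpperSet B) (hst : IsBistable B)
    {a b : Fin n ⊕ Fin m} (hab : VarLT a b) {t w : Fin n ⊕ Fin m →₀ ℕ} (ht : t ∈ B)
    (h : t ≤ w + Finsupp.single a 1) (hb : t b < w b) : w ∈ B := by
  by_cases ha : t a ≤ w a
  · exact hB (le_of_le_add_single h ha) ht
  refine hB (fun v => ?_) (hst a b hab t ht (by omega))
  have hv := h v
  by_cases hva : v = a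
  · subst hva
    simp only [Finsupp.add_apply, Finsupp.tsub_apply, Finsupp.single_eq_same] at hv ⊢
    rw [Finsupp.single_eq_of_ne hab.ne]
    omega
  · by_cases hvb : v = b
    · subst hvb
      simp [hab.ne.symm]
      omega
    · simpa [hva, hvb] using hv

/-- A generator dividing `w x_k` has smaller `y`-degree than `w`, so some `y_l` can be cancelled
from `w` without losing this divisor. -/
theorem HasGap.pred (hB : IsUpperSet B) {μ : ℕ} (hμ : ∀ t ∈ minExps B, yDeg t ≤ μ) {k : Fin n}
    {j : ℕ} (hj : μ ≤ j) {a : ℤ} (h : HasGap B k (j + 1 : ℕ) a) : HasGap B k j a := by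
  obtain ⟨w, hwa, hwj, hwk, hwB, hwB'⟩ := h
  obtain ⟨t, ht, htw⟩ := exists_minExps_le hwB'
  have hlt : yDeg t < yDeg w := by have := hμ t ht; omega
  obtain ⟨l, -, hl⟩ := Finset.exists_lt_of_sum_lt hlt
  have hle : Finsupp.single (Sum.inr l) 1 ≤ w := by rw [Finsupp.single_le_iff]; omega
  obtain ⟨w', rfl⟩ := exists_add_of_le hle
  rw [xDeg_add, xDeg_single_inr] at hwa
  rw [yDeg_add, yDeg_single_inr] at hwj
  refine ⟨w', by omega, by omega, fun v hv => ?_, fun h => hwB (hB le_add_self h), ?_⟩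
  · simpa using hwk v hv
  · refine hB (le_of_le_add_single (a := Sum.inr l) ?_ ?_) ht.1
    · convert htw using 1; abel
    · simp at hl ⊢; omega

/-- Multiply `w` by the last variable `y_m`. If the product were in `B`, a generator dividing it
would leave some `y_l` to spare; if that generator does not already divide `w`, trading its excess
`y_m` for `y_l` shows `w ∈ B`. Every other `y_l` is an allowed trade because `y_m` is the smallest.
-/
theorem HasGap.succ (hB : IsUpperSet B) (hst : IsBistable B) {μ : ℕ}
    (hμ : ∀ t ∈ minExps B, yDeg t ≤ μ) (hm : 0 < m) {k : Fin n} {j : ℕ} (hj : μ ≤ j) {a : ℤ}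
    (h : HasGap B k j a) : HasGap B k (j + 1 : ℕ) a := by
  obtain ⟨w, hwa, hwj, hwk, hwB, hwB'⟩ := h
  set l₀ : Fin m := ⟨m - 1, by omega⟩ with hl₀
  refine ⟨w + Finsupp.single (Sum.inr l₀) 1, ?_, ?_, fun v hv => ?_, fun h => hwB ?_, ?_⟩
  · rw [xDeg_add, xDeg_single_inr]; omega
  · rw [yDeg_add, yDeg_single_inr]; omega
  · simpa using hwk v hv
  · obtain ⟨t, ht, htw⟩ := exists_minExps_le h
    have hlt : yDeg t < yDeg (w + Finsupp.single (Sum.inr l₀) 1) := by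
      rw [yDeg_add, yDeg_single_inr]
      have := hμ t ht; omega
    obtain ⟨l, -, hl⟩ := Finset.exists_lt_of_sum_lt hlt
    by_cases hll : l = l₀
    · subst hll
      refine hB (le_of_le_add_single htw ?_) ht.1
      simp at hl; omega
    · have hlt' : l < l₀ := lt_of_le_of_ne (Fin.le_def.2 (by simp [hl₀]; omega)) hll
      refine hst.mem_of_le_add_single hB (VarLT.inr hlt') ht.1 htw ?_
      simpa [hll] using hl
  · rw [add_right_comm]
    exact hB le_self_add hwB'

/-- Beyond the `y`-degrees of the generators, the gaps do not depend on the `y`-degree. -/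
theorem hasGap_iff (hB : IsUpperSet B) (hst : IsBistable B) {μ : ℕ}
    (hμ : ∀ t ∈ minExps B, yDeg t ≤ μ) (hm : 0 < m) {k : Fin n} {j : ℕ} (hj : μ ≤ j) {a : ℤ} :
    HasGap B k j a ↔ HasGap B k μ a := by
  induction j, hj using Nat.le_induction with
  | base => rfl
  | succ j hj ih => exact ⟨fun h => ih.1 (h.pred hB hμ hj), fun h => (ih.2 h).succ hB hst hμ hm hj⟩

/-- The `x`-degrees of gaps are bounded. -/
theorem HasGap.lt_of_bound (hB : IsUpperSet B) (hst : IsBistable B) {D : ℕ}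
    (hD : ∀ t ∈ minExps B, xDeg t ≤ D) {k : Fin n} {j a : ℤ} (h : HasGap B k j a) : a < D := by
  obtain ⟨w, hwa, hwj, hwk, hwB, hwB'⟩ := h
  by_contra hcon
  obtain ⟨t, ht, htw⟩ := exists_minExps_le hwB'
  have hlt : xDeg t < xDeg (w + Finsupp.single (Sum.inl k) 1) := by
    rw [xDeg_add, xDeg_single_inl]
    have := hD t ht; omega
  obtain ⟨v, -, hv⟩ := Finset.exists_lt_of_sum_lt hlt
  apply hwB
  -- The generator `t` leaves some `x_v` of `w x_k` to spare. For `v < k` trade `x_k` for it, for `v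
  -- = k` the generator already divides `w`, and later variables do not occur.
  rcases lt_trichotomy v k with hvk | rfl | hvk
  · refine hst.mem_of_le_add_single hB (VarLT.inl hvk) ht.1 htw ?_
    simpa [hvk.ne] using hv
  · refine hB (le_of_le_add_single htw ?_) ht.1
    simp at hv; omega
  · simp [hwk v hvk, hvk.ne'] at hv

end Stable

/-! ### Koszul strands and gaps in generic coordinates. -/

section Homogeneous

variable {σ τ K G G' : Type*} [CommRing K] [AddCommMonoid G] [AddCommMonoid G']

theorem isWeightedHomogeneous_algHom {w : σ → G} {w' : τ → G'} (ψ : G →+ G')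
    {φ : MvPolynomial σ K →ₐ[K] MvPolynomial τ K}
    (h : ∀ v, IsWeightedHomogeneous w' (φ (X v)) (ψ (w v))) {p : MvPolynomial σ K} {γ : G}
    (hp : IsWeightedHomogeneous w p γ) : IsWeightedHomogeneous w' (φ p) (ψ γ) := by
  rw [p.as_sum, map_sum]
  refine IsWeightedHomogeneous.sum _ _ _ fun s hs => ?_
  rw [monomial_eq, map_mul, ← algebraMap_eq, AlgHom.commutes, algebraMap_eq, Finsupp.prod, map_prod]
  refine IsWeightedHomogeneous.C_mul ?_ _
  have hγ : ψ γ = ∑ v ∈ s.support, s v • ψ (w v) := by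
    rw [← hp (mem_support_iff.1 hs), Finsupp.weight_apply, Finsupp.sum, map_sum]
    exact Finset.sum_congr rfl fun v _ => map_nsmul _ _ _
  rw [hγ]
  refine IsWeightedHomogeneous.prod _ _ _ fun v _ => ?_
  rw [map_pow]
  exact (h v).pow _

variable {K : Type*} [Field K] {n m : ℕ}

theorem biAct_mem_biPart (g : GL (Fin n) K × GL (Fin m) K) {δ : ℤ × ℤ} {p : BiPoly K n m}
    (hp : p ∈ biPart K n m δ) : biAct g p ∈ biPart K n m δ := by
  refine isWeightedHomogeneous_algHom (AddMonoidHom.id _) (fun v => ?_) hp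
  rcases v with j | l
  · rw [biAct_X_inl]
    exact IsWeightedHomogeneous.sum _ _ _ fun i _ =>
      (isWeightedHomogeneous_X K (biWeight n m) (Sum.inl i)).C_mul _
  · rw [biAct_X_inr]
    exact IsWeightedHomogeneous.sum _ _ _ fun i _ =>
      (isWeightedHomogeneous_X K (biWeight n m) (Sum.inr i)).C_mul _

theorem component_biAct (g : GL (Fin n) K × GL (Fin m) K) (δ : ℤ × ℤ) (p : BiPoly K n m) :
    weightedHomogeneousComponent (biWeight n m) δ (biAct g p) =
      biAct g (weightedHomogeneousComponent (biWeight n m) δ p) := by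
  induction p using MvPolynomial.induction_on' with
  | monomial s c =>
    have hs : (monomial s c : BiPoly K n m) ∈ biPart K n m (Finsupp.weight (biWeight n m) s) :=
      isWeightedHomogeneous_monomial _ _ _ rfl
    rw [weightedHomogeneousComponent_of_mem hs,
      weightedHomogeneousComponent_of_mem (biAct_mem_biPart g hs)]
    split_ifs
    · rfl
    · rw [map_zero]
  | add p q hp hq => simp only [map_add, hp, hq]

theorem IsBihomogeneous.map_biAct {J : Ideal (BiPoly K n m)} (hJ : IsBihomogeneous J)
    (g : GL (Fin n) K × GL (Fin m) K) : IsBihomogeneous (J.map (biAct g)) := by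
  intro p hp δ
  obtain ⟨q, hq, rfl⟩ := mem_map_biAct_iff.1 hp
  rw [component_biAct]
  exact Ideal.mem_map_of_mem _ (hJ q hq δ)

theorem tailIdeal_eq_sup (J : Ideal (BiPoly K n m)) (k : Fin n) :
    tailIdeal J k = tailIdeal J (k + 1) ⊔ Ideal.span {X (Sum.inl k)} := by
  rw [tailIdeal, tailIdeal, sup_assoc, ← Ideal.span_union]
  congr 2
  ext p
  simp only [Set.mem_image, exists_exists_and_eq_and, Set.mem_union, Set.mem_singleton_iff,
    Set.mem_ofPred_eq]
  constructor
  · rintro ⟨v, hv, rfl⟩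
    rcases eq_or_lt_of_le (Fin.le_def.2 hv) with rfl | h
    · exact Or.inr rfl
    · exact Or.inl ⟨v, Nat.succ_le_of_lt (Fin.lt_def.1 h), rfl⟩
  · rintro (⟨v, hv, rfl⟩ | rfl)
    · exact ⟨v, by omega, rfl⟩
    · exact ⟨k, le_rfl, rfl⟩

/-- The ideal `J + (l_k, …, l_n)` with `l_v` the preimage of `x_v` under `g`. -/
noncomputable def genericTail (J : Ideal (BiPoly K n m)) (g : GL (Fin n) K × GL (Fin m) K)
    (k : ℕ) : Ideal (BiPoly K n m) :=
  (tailIdeal (J.map (biAct g)) k).map (biAct g⁻¹)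

theorem mem_genericTail_iff {J : Ideal (BiPoly K n m)} {g : GL (Fin n) K × GL (Fin m) K} {k : ℕ}
    {p : BiPoly K n m} :
    p ∈ genericTail J g k ↔ biAct g p ∈ tailIdeal (J.map (biAct g)) k := by
  rw [genericTail, mem_map_biAct_iff]
  constructor
  · rintro ⟨q, hq, rfl⟩
    rwa [biAct_biAct_inv]
  · intro h
    exact ⟨_, h, biAct_inv_biAct g p⟩

theorem genericTail_self (J : Ideal (BiPoly K n m)) (g : GL (Fin n) K × GL (Fin m) K) :
    genericTail J g n = J := by
  ext p
  have : {v : Fin n | n ≤ (v : ℕ)} = ∅ := by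
    ext v; simp
  rw [mem_genericTail_iff, tailIdeal, this, Set.image_empty, Set.image_empty, Ideal.span_empty,
    sup_bot_eq, mem_map_biAct_iff]
  constructor
  · rintro ⟨q, hq, h⟩
    rwa [← biAct_injective g h]
  · intro h; exact ⟨p, h, rfl⟩

theorem biAct_X_inl_eq_xForm (g : GL (Fin n) K × GL (Fin m) K) (k : Fin n) :
    biAct g (X (Sum.inl k)) = xForm m fun v => g.1.1 v k := by
  rw [biAct_X_inl, xForm]

theorem genericTail_eq_sup (J : Ideal (BiPoly K n m)) (g : GL (Fin n) K × GL (Fin m) K)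
    (k : Fin n) : genericTail J g k =
      genericTail J g (k + 1) ⊔ Ideal.span {xForm m fun v => g⁻¹.1.1 v k} := by
  rw [genericTail, tailIdeal_eq_sup, Ideal.map_sup, Ideal.map_span, Set.image_singleton,
    biAct_X_inl_eq_xForm, genericTail]

theorem isBihomogeneous_genericTail {J : Ideal (BiPoly K n m)} (hJ : IsBihomogeneous J)
    (g : GL (Fin n) K × GL (Fin m) K) {k : ℕ} (hk : k ≤ n) :
    IsBihomogeneous (genericTail J g k) := by
  induction hk using Nat.decreasingInduction with
  | of_succ k hk ih =>
    rw [genericTail_eq_sup J g ⟨k, hk⟩]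
    exact ih.sup_span_singleton (xForm_mem_biPart _)
  | self => rwa [genericTail_self]

theorem regularAt_genericTail_iff {J : Ideal (BiPoly K n m)} (hJ : IsBihomogeneous J)
    (g : GL (Fin n) K × GL (Fin m) K) (k : Fin n) {j a : ℤ} :
    RegularAt (genericTail J g (k + 1)) (xForm m fun v => g⁻¹.1.1 v k) j a ↔
      ¬ HasGap (leadSet (J.map (biAct g))) k j a := by
  rw [← regularAt_tailIdeal_iff (hJ.map_biAct g), ← biAct_X_inl_eq_xForm]
  constructor
  · intro h p hp hXp
    have := h (biAct g⁻¹ p) (biAct_mem_biPart _ hp) (by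
      rw [mem_genericTail_iff, map_mul, biAct_biAct_inv, biAct_biAct_inv]; exact hXp)
    rwa [mem_genericTail_iff, biAct_biAct_inv] at this
  · intro h p hp hXp
    rw [mem_genericTail_iff, map_mul, biAct_biAct_inv] at hXp
    rw [mem_genericTail_iff]
    exact h _ (biAct_mem_biPart _ hp) hXp

/-- With all the linear forms adjoined, the ideal contains everything of positive `x`-degree. This
starts the induction for strands above `r` and accounts for the condition `0 ≤ r` there. -/
theorem strandExactMod_genericTail_zero (J : Ideal (BiPoly K n m))
    (g : GL (Fin n) K × GL (Fin m) K) {j a : ℤ} (ha : 0 < a) :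
    StrandExactMod (genericTail J g 0) j a := by
  intro z hz _
  refine ⟨0, fun T => zero_mem _, fun T => ?_⟩
  rw [map_zero, Pi.zero_apply, sub_zero, mem_genericTail_iff]
  refine Ideal.mem_sup_right ?_
  rw [mem_ideal_span_X_image]
  intro s hs
  have := mem_biPart_iff.1 (biAct_mem_biPart g (hz T)) s hs
  have hpos : 0 < xDeg s := by simp only at this; omega
  obtain ⟨v, -, hv⟩ := Finset.exists_ne_zero_of_sum_ne_zero hpos.ne'
  exact ⟨Sum.inl v, ⟨v, Nat.zero_le _, rfl⟩, hv⟩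

/-- Vanishing of the Koszul homology in the strands `a > r` in terms of the gaps of an initial
ideal of `gJ`. -/
theorem forall_strandExactMod_iff_hasGap {J : Ideal (BiPoly K n m)} (hJ : IsBihomogeneous J)
    (g : GL (Fin n) K × GL (Fin m) K) {j D : ℤ}
    (hD : ∀ k a, HasGap (leadSet (J.map (biAct g))) k j a → a < D) {r : ℤ} (hr : 0 ≤ r) :
    (∀ a > r, StrandExactMod J j a) ↔
      ∀ a > r, ∀ k, ¬ HasGap (leadSet (J.map (biAct g))) k j a := by
  -- Remove the linear forms one at a time, from `k = 0`, where all are adjoined, up to `k = n`,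
  -- where only `J` is left; the step at `k` contributes the gaps for `x_k`.
  have main : ∀ k : ℕ, k ≤ n → ((∀ a > r, StrandExactMod (genericTail J g k) j a) ↔
      ∀ a > r, ∀ k' : Fin n, (k' : ℕ) < k → ¬ HasGap (leadSet (J.map (biAct g))) k' j a) := by
    intro k
    induction k with
    | zero =>
      intro _
      simp only [Nat.not_lt_zero, false_implies, implies_true, iff_true]
      exact fun a ha => strandExactMod_genericTail_zero J g (by omega)
    | succ k ih =>
      intro hk
      rw [forall_strandExactMod_iff (isBihomogeneous_genericTail hJ g hk)
        (c := fun v => g⁻¹.1.1 v ⟨k, hk⟩) (D := D) (fun a ha =>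
          (regularAt_genericTail_iff hJ g ⟨k, hk⟩).2 fun h => by
            have := hD _ _ h; omega) r, ← genericTail_eq_sup J g ⟨k, hk⟩, ih (by omega)]
      constructor
      · rintro ⟨h1, h2⟩ a ha k' hk'
        rcases Nat.lt_succ_iff_lt_or_eq.1 hk' with h | h
        · exact h2 a ha k' h
        · have : k' = ⟨k, hk⟩ := Fin.ext h
          rw [this]
          exact (regularAt_genericTail_iff hJ g ⟨k, hk⟩).1 (h1 a ha)
      · intro h
        exact ⟨fun a ha => (regularAt_genericTail_iff hJ g ⟨k, hk⟩).2 (h a ha _ (Nat.lt_succ_self k)),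
          fun a ha k' hk' => h a ha k' (by omega)⟩
  have := main n le_rfl
  rw [genericTail_self] at this
  rw [this]
  exact ⟨fun h a ha k => h a ha k k.2, fun h a ha k _ => h a ha k⟩

end Homogeneous

/-! ### The Rees algebra in a fixed y-degree. -/

section Rees

variable {K : Type*} [Field K] {n m : ℕ}

/-- The map `S → S_x`, `x_i ↦ x_i`, `y_j ↦ f_j`. -/
noncomputable def reesEval (f : Fin m → MvPolynomial (Fin n) K) :
    BiPoly K n m →ₐ[K] MvPolynomial (Fin n) K :=
  aeval (Sum.elim X f)

theorem coe_reesMap_X_inl (f : Fin m → MvPolynomial (Fin n) K) (i : Fin n) :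
    (reesMap f (X (Sum.inl i)) : Polynomial (MvPolynomial (Fin n) K)) =
      Polynomial.monomial 0 (X i) := by
  rw [reesMap, aeval_X]
  rfl

theorem coe_reesMap_X_inr (f : Fin m → MvPolynomial (Fin n) K) (j : Fin m) :
    (reesMap f (X (Sum.inr j)) : Polynomial (MvPolynomial (Fin n) K)) =
      Polynomial.monomial 1 (f j) := by
  rw [reesMap, aeval_X]
  rfl

theorem coe_reesMap_C (f : Fin m → MvPolynomial (Fin n) K) (c : K) :
    (reesMap f (C c) : Polynomial (MvPolynomial (Fin n) K)) = Polynomial.monomial 0 (C c) := by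
  rw [← algebraMap_eq, AlgHom.commutes]
  rfl

theorem coe_reesMap_monomial_one (f : Fin m → MvPolynomial (Fin n) K)
    (s : Fin n ⊕ Fin m →₀ ℕ) :
    (reesMap f (monomial s 1) : Polynomial (MvPolynomial (Fin n) K)) =
      Polynomial.monomial (yDeg s) (reesEval f (monomial s 1)) := by
  induction s using Finsupp.induction_linear with
  | zero =>
    have h1 : (monomial 0 1 : BiPoly K n m) = 1 := rfl
    have h2 : yDeg (0 : Fin n ⊕ Fin m →₀ ℕ) = 0 := by simp [yDeg]
    rw [h1, h2, map_one, map_one]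
    rfl
  | add s t hs ht =>
    have h : (monomial (s + t) 1 : BiPoly K n m) = monomial s 1 * monomial t 1 := by
      rw [monomial_mul, one_mul]
    rw [h, map_mul, map_mul, yDeg_add, ← Polynomial.monomial_mul_monomial, ← hs, ← ht]
    rfl
  | single v k =>
    rw [← X_pow_eq_monomial, map_pow, map_pow]
    rcases v with i | j
    · have : yDeg (Finsupp.single (Sum.inl i) k : Fin n ⊕ Fin m →₀ ℕ) = 0 := by simp [yDeg]
      rw [SubmonoidClass.coe_pow, coe_reesMap_X_inl, this, Polynomial.monomial_pow]
      simp [reesEval]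
    · have : yDeg (Finsupp.single (Sum.inr j) k : Fin n ⊕ Fin m →₀ ℕ) = k := by
        simp [yDeg, Finsupp.single_apply]
      rw [SubmonoidClass.coe_pow, coe_reesMap_X_inr, this, Polynomial.monomial_pow]
      simp [reesEval]

theorem coe_reesMap_monomial (f : Fin m → MvPolynomial (Fin n) K)
    (s : Fin n ⊕ Fin m →₀ ℕ) (c : K) :
    (reesMap f (monomial s c) : Polynomial (MvPolynomial (Fin n) K)) =
      Polynomial.monomial (yDeg s) (reesEval f (monomial s c)) := by
  have h : (monomial s c : BiPoly K n m) = C c * monomial s 1 := by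
    rw [C_mul_monomial, mul_one]
  have hC : reesEval f (C c) = C c := by rw [← algebraMap_eq, AlgHom.commutes, algebraMap_eq]
  rw [h, map_mul, map_mul, MulMemClass.coe_mul, coe_reesMap_C, coe_reesMap_monomial_one,
    Polynomial.monomial_mul_monomial, zero_add, hC]

theorem coe_reesMap_of_mem_biPart (f : Fin m → MvPolynomial (Fin n) K) {a : ℤ} {j : ℕ}
    {p : BiPoly K n m} (hp : p ∈ biPart K n m (a, j)) :
    (reesMap f p : Polynomial (MvPolynomial (Fin n) K)) =
      Polynomial.monomial j (reesEval f p) := by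
  conv_lhs => rw [p.as_sum, map_sum, AddSubmonoidClass.coe_finsetSum]
  conv_rhs => rw [p.as_sum, map_sum, map_sum]
  refine Finset.sum_congr rfl fun s hs => ?_
  have : yDeg s = j := by
    have := (mem_biPart_iff.1 hp s hs).2
    simpa using this
  rw [coe_reesMap_monomial, this]

/-- A form of `y`-degree `j` maps to a multiple of `t^j` alone, so setting `t = 1` loses nothing. -/
theorem mem_reesIdeal_iff {f : Fin m → MvPolynomial (Fin n) K} {a : ℤ} {j : ℕ}
    {p : BiPoly K n m} (hp : p ∈ biPart K n m (a, j)) :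
    p ∈ reesIdeal f ↔ reesEval f p = 0 := by
  rw [reesIdeal, RingHom.mem_ker, ← ZeroMemClass.coe_eq_zero, coe_reesMap_of_mem_biPart f hp,
    Polynomial.monomial_eq_zero_iff]

/-- The degree shift from `S` to `S_x` under `x_i ↦ x_i`, `y_j ↦ f_j`. -/
def degShift (d : ℕ) : ℤ × ℤ →+ ℤ where
  toFun δ := δ.1 + δ.2 * d
  map_zero' := by simp
  map_add' δ ε := by simp; ring

theorem isWeightedHomogeneous_one_of_isHomogeneous {p : MvPolynomial (Fin n) K} {d : ℕ}
    (hp : p.IsHomogeneous d) : IsWeightedHomogeneous (fun _ : Fin n => (1 : ℤ)) p d := by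
  intro s hs
  have := hp hs
  rw [Finsupp.weight_apply] at this ⊢
  simp only [Finsupp.sum, Pi.one_apply, smul_eq_mul, mul_one] at this
  simp only [Finsupp.sum, nsmul_eq_mul, mul_one]
  rw [← this]; push_cast; rfl

theorem reesEval_isWeightedHomogeneous {d : ℕ} {f : Fin m → MvPolynomial (Fin n) K}
    (hf : ∀ j, (f j).IsHomogeneous d) {δ : ℤ × ℤ} {p : BiPoly K n m}
    (hp : p ∈ biPart K n m δ) :
    IsWeightedHomogeneous (fun _ : Fin n => (1 : ℤ)) (reesEval f p) (degShift d δ) := by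
  refine isWeightedHomogeneous_algHom (degShift d) (fun v => ?_) hp
  rcases v with i | j
  · simpa [reesEval, degShift, biWeight] using
      isWeightedHomogeneous_X K (fun _ : Fin n => (1 : ℤ)) i
  · simpa [reesEval, degShift, biWeight] using
      isWeightedHomogeneous_one_of_isHomogeneous (hf j)

/-- The presentation respects the bigrading; the bihomogeneity of `J` and the description of the
graded pieces of `I^j` both rest on this. -/
theorem component_coeff_reesMap {d : ℕ} {f : Fin m → MvPolynomial (Fin n) K}
    (hf : ∀ j, (f j).IsHomogeneous d) (a : ℤ) (j : ℕ) (p : BiPoly K n m) :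
    weightedHomogeneousComponent (fun _ : Fin n => (1 : ℤ)) (degShift d (a, j))
      ((reesMap f p : Polynomial (MvPolynomial (Fin n) K)).coeff j) =
      reesEval f (weightedHomogeneousComponent (biWeight n m) (a, j) p) := by
  induction p using MvPolynomial.induction_on' with
  | monomial s c =>
    have hs : (monomial s c : BiPoly K n m) ∈ biPart K n m (xDeg s, yDeg s) :=
      isWeightedHomogeneous_monomial _ _ _ (weight_biWeight s)
    rw [weightedHomogeneousComponent_of_mem hs, coe_reesMap_monomial, Polynomial.coeff_monomial]
    by_cases hj : yDeg s = j
    · subst hj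
      rw [if_pos rfl, weightedHomogeneousComponent_of_mem (reesEval_isWeightedHomogeneous hf hs)]
      by_cases ha : a = xDeg s
      · rw [ha, if_pos rfl, if_pos rfl]
      · rw [if_neg (by simpa [degShift] using ha), if_neg (by simpa using ha), map_zero]
    · rw [if_neg hj, map_zero, if_neg (by simp [Ne.symm hj]), map_zero]
  | add p q hp hq =>
    simp only [map_add, AddMemClass.coe_add, Polynomial.coeff_add, hp, hq]

theorem isBihomogeneous_reesIdeal {d : ℕ} {f : Fin m → MvPolynomial (Fin n) K}
    (hf : ∀ j, (f j).IsHomogeneous d) : IsBihomogeneous (reesIdeal f) := by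
  rintro p hp ⟨a, b⟩
  rcases lt_or_ge b 0 with hb | hb
  · rw [biPart_eq_zero (Or.inr hb) (component_mem_biPart (a, b) p)]
    exact zero_mem _
  · obtain ⟨j, rfl⟩ := Int.eq_ofNat_of_zero_le hb
    have hc := component_mem_biPart (a, (j : ℤ)) p
    rw [mem_reesIdeal_iff hc, ← component_coeff_reesMap hf]
    rw [reesIdeal, RingHom.mem_ker] at hp
    rw [hp]
    simp

theorem exists_coe_reesMap_eq_C (f : Fin m → MvPolynomial (Fin n) K)
    (r : MvPolynomial (Fin n) K) : ∃ h : BiPoly K n m,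
      (reesMap f h : Polynomial (MvPolynomial (Fin n) K)) = Polynomial.monomial 0 r := by
  induction r using MvPolynomial.induction_on with
  | C c => exact ⟨C c, coe_reesMap_C f c⟩
  | add p q hp hq =>
    obtain ⟨h, hh⟩ := hp
    obtain ⟨h', hh'⟩ := hq
    exact ⟨h + h', by rw [map_add, AddMemClass.coe_add, hh, hh', map_add]⟩
  | mul_X p i hp =>
    obtain ⟨h, hh⟩ := hp
    exact ⟨h * X (Sum.inl i), by
      rw [map_mul, MulMemClass.coe_mul, hh, coe_reesMap_X_inl,
        Polynomial.monomial_mul_monomial, add_zero]⟩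

theorem exists_coe_reesMap_eq_monomial_one (f : Fin m → MvPolynomial (Fin n) K)
    {p : MvPolynomial (Fin n) K} (hp : p ∈ Ideal.span (Set.range f)) : ∃ h : BiPoly K n m,
      (reesMap f h : Polynomial (MvPolynomial (Fin n) K)) = Polynomial.monomial 1 p := by
  induction hp using Submodule.span_induction with
  | mem p hp =>
    obtain ⟨j, rfl⟩ := hp
    exact ⟨X (Sum.inr j), coe_reesMap_X_inr f j⟩
  | zero => exact ⟨0, by simp⟩
  | add p q _ _ hp hq =>
    obtain ⟨h, hh⟩ := hp
    obtain ⟨h', hh'⟩ := hq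
    exact ⟨h + h', by rw [map_add, AddMemClass.coe_add, hh, hh', map_add]⟩
  | smul r p _ hp =>
    obtain ⟨h, hh⟩ := hp
    obtain ⟨h', hh'⟩ := exists_coe_reesMap_eq_C f r
    exact ⟨h' * h, by rw [map_mul, MulMemClass.coe_mul, hh, hh',
      Polynomial.monomial_mul_monomial, zero_add, smul_eq_mul]⟩

theorem exists_coe_reesMap_eq_monomial (f : Fin m → MvPolynomial (Fin n) K) (j : ℕ)
    {p : MvPolynomial (Fin n) K} (hp : p ∈ Ideal.span (Set.range f) ^ j) : ∃ h : BiPoly K n m,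
      (reesMap f h : Polynomial (MvPolynomial (Fin n) K)) = Polynomial.monomial j p := by
  induction j generalizing p with
  | zero => exact exists_coe_reesMap_eq_C f p
  | succ j ih =>
    rw [pow_succ] at hp
    refine Submodule.mul_induction_on hp (fun r hr s hs => ?_) (fun p q hp hq => ?_)
    · obtain ⟨h, hh⟩ := ih hr
      obtain ⟨h', hh'⟩ := exists_coe_reesMap_eq_monomial_one f hs
      exact ⟨h * h', by rw [map_mul, MulMemClass.coe_mul, hh, hh',
        Polynomial.monomial_mul_monomial]⟩
    · obtain ⟨h, hh⟩ := hp
      obtain ⟨h', hh'⟩ := hq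
      exact ⟨h + h', by rw [map_add, AddMemClass.coe_add, hh, hh', map_add]⟩

theorem image_idealPart_eq {d : ℕ} {f : Fin m → MvPolynomial (Fin n) K}
    (hf : ∀ j, (f j).IsHomogeneous d) (j : ℕ) {a l : ℤ} (hl : l = degShift d (a, j)) :
    (Submodule.subtype (Ideal.span (Set.range f) ^ j)).toAddMonoidHom ''
      (idealPart (Ideal.span (Set.range f) ^ j) l : Set _) =
      (reesEval f : BiPoly K n m →+ MvPolynomial (Fin n) K) ''
        (biPart K n m (a, j) : Set (BiPoly K n m)) := by
  subst hl
  ext p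
  constructor
  · rintro ⟨⟨p, hpI⟩, hp, rfl⟩
    obtain ⟨h, hh⟩ := exists_coe_reesMap_eq_monomial f j hpI
    refine ⟨_, component_mem_biPart (a, (j : ℤ)) h, ?_⟩
    have := component_coeff_reesMap hf a j h
    rw [hh, Polynomial.coeff_monomial, if_pos rfl] at this
    refine this.symm.trans ?_
    exact IsWeightedHomogeneous.weightedHomogeneousComponent_same hp
  · rintro ⟨h, hh, rfl⟩
    refine ⟨⟨reesEval f h, ?_⟩, reesEval_isWeightedHomogeneous hf hh, rfl⟩
    have := (mem_reesAlgebra_iff _ _).1 (reesMap f h).2 j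
    rwa [coe_reesMap_of_mem_biPart f hh, Polynomial.coeff_monomial, if_pos rfl] at this

/-- The graded Betti numbers of `I ^ j` in terms of the Koszul complex of `x_1, …, x_n` on the
component of `y`-degree `j` of the Rees algebra. -/
theorem forall_koszulBetti_pow_eq_zero_iff {d : ℕ} {f : Fin m → MvPolynomial (Fin n) K}
    (hf : ∀ j, (f j).IsHomogeneous d) (j : ℕ) (a : ℤ) :
    (∀ i : ℕ, koszulBetti (fun v : Fin n => (X v : MvPolynomial (Fin n) K)) (fun _ => (1 : ℤ))
      (idealPart (Ideal.span (Set.range f) ^ j)) i (i + (a + j * d)) = 0) ↔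
      StrandExactMod (reesIdeal f) j a := by
  have h := forall_koszulBetti_eq_zero_iff (r := fun v : Fin n => (X v : MvPolynomial (Fin n) K))
    (e := fun _ => (1 : ℤ)) (𝓜 := idealPart (Ideal.span (Set.range f) ^ j)) 1 (a + j * d)
  simp only [nsmul_eq_mul, mul_one, Finset.sum_const, add_sub_cancel_right] at h
  simp only [add_comm _ (a + (j : ℤ) * (d : ℤ))]
  -- Chains in `S` and in `I^j` are compared inside `S_x`: the former through `y_l ↦ f_l`, the
  -- latter through the inclusion.
  rw [h, koszulExact_iff_of_image_eq (R := BiPoly K n m) (R'' := MvPolynomial (Fin n) K)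
    (reesEval f : BiPoly K n m →+ MvPolynomial (Fin n) K)
    (Submodule.subtype (Ideal.span (Set.range f) ^ j)).toAddMonoidHom Subtype.val_injective
    (r := fun v : Fin n => (X (Sum.inl v) : BiPoly K n m))
    (s := fun v : Fin n => (X v : MvPolynomial (Fin n) K))
    (𝓐 := fun _ => biPart K n m (a, j)) (𝓑 := fun _ => biPart K n m (a - 1, j))
    (fun v x => by simp [reesEval]) (fun v x => rfl)
    (fun T => image_idealPart_eq hf j (by simp [degShift]))
    (fun T => image_idealPart_eq hf j (by simp [degShift]; ring))]
  refine forall_congr' fun z => forall_congr' fun hz => ?_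
  have hdz := fun T => xDiff_mem_biPart (γ := (a + 1, (j : ℤ))) (by simp) hz T
  refine imp_congr (forall_congr' fun T => (mem_reesIdeal_iff (hdz T)).symm) ?_
  refine exists_congr fun w => and_congr_right fun hw => forall_congr' fun T => ?_
  exact (mem_reesIdeal_iff (sub_mem (hz T) (xDiff_mem_biPart (by simp) hw T))).symm

end Rees

/-! ### Discarding the y-variables. -/

section Elimination

variable {K : Type*} [Field K] {n m : ℕ}

theorem mul_mem_quotPart {J : Ideal (BiPoly K n m)} {δ ε : ℤ × ℤ} {p : BiPoly K n m}
    (hp : p ∈ biPart K n m ε) {x : BiPoly K n m ⧸ J} (hx : x ∈ quotPart J δ) :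
    p • x ∈ quotPart J (δ + ε) := by
  obtain ⟨q, hq, rfl⟩ := hx
  exact ⟨p * q, mul_mem_biPart hp hq (add_comm _ _), rfl⟩

theorem quotPart_eq_zero {J : Ideal (BiPoly K n m)} {δ : ℤ × ℤ} (h : δ.2 < 0)
    {x : BiPoly K n m ⧸ J} (hx : x ∈ quotPart J δ) : x = 0 := by
  obtain ⟨q, hq, rfl⟩ := hx
  rw [biPart_eq_zero (Or.inr h) hq, map_zero]

/-- A double induction. By `KoszulExactOn.of_insert`, discarding one more `y` in `y`-degree `b`
requires exactness without it in `y`-degree `b - 1`, and for `b < 0` all components vanish. -/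
theorem koszulExactOn_compl_map {J : Ideal (BiPoly K n m)} {a : ℤ}
    (h : ∀ (i : ℕ) (b : ℤ), biBetti J i (a + i, b) = 0) (Y : Finset (Fin m)) (b : ℤ) :
    KoszulExactOn
      (Fin.append (fun i : Fin n => (X (Sum.inl i) : BiPoly K n m)) (fun j : Fin m => X (Sum.inr j)))
      (Fin.append (fun _ : Fin n => ((1, 0) : ℤ × ℤ)) (fun _ : Fin m => (0, 1)))
      (quotPart J) (1, 0) (Y.map (Fin.natAddEmb n))ᶜ (a, b) := by
  induction Y using Finset.induction_on generalizing b with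
  | empty =>
    have h' := (forall_koszulBetti_eq_zero_iff
      (r := Fin.append (fun i : Fin n => (X (Sum.inl i) : BiPoly K n m))
        (fun j : Fin m => X (Sum.inr j)))
      (e := Fin.append (fun _ : Fin n => ((1, 0) : ℤ × ℤ)) (fun _ : Fin m => (0, 1)))
      (𝓜 := quotPart J) (1, 0) (a, b)).1 (fun i => by simpa [biBetti] using h i b)
    simpa [KoszulExactOn] using h'
  | insert y Y hy ih =>
    have hins : (Y.map (Fin.natAddEmb n))ᶜ =
        insert (Fin.natAdd n y) ((insert y Y).map (Fin.natAddEmb n))ᶜ := by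
      rw [Finset.map_insert, Finset.compl_insert]
      refine (Finset.insert_erase ?_).symm
      rw [Finset.mem_compl]
      intro h
      exact hy ((Finset.mem_map' (Fin.natAddEmb n)).1 h)
    have hmem : Fin.natAdd n y ∉ ((insert y Y).map (Fin.natAddEmb n))ᶜ := by
      rw [Finset.notMem_compl]
      exact (Finset.mem_map' (Fin.natAddEmb n)).2 (Finset.mem_insert_self _ _)
    rw [hins] at ih
    have hneg : ∀ b : ℤ, b < 0 → KoszulExactOn
        (Fin.append (fun i : Fin n => (X (Sum.inl i) : BiPoly K n m))
          (fun j : Fin m => X (Sum.inr j)))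
        (Fin.append (fun _ : Fin n => ((1, 0) : ℤ × ℤ)) (fun _ : Fin m => (0, 1)))
        (quotPart J) (1, 0) ((insert y Y).map (Fin.natAddEmb n))ᶜ (a, b) := by
      intro b hb z hz _
      have : z = 0 := by
        funext T
        have hT := hz T
        rw [mem_ite_bot] at hT
        by_cases hTA : T ⊆ ((insert y Y).map (Fin.natAddEmb n))ᶜ
        · refine quotPart_eq_zero ?_ (hT.1 hTA)
          have h0 : 0 ≤ (∑ v ∈ T, Fin.append (fun _ : Fin n => ((1, 0) : ℤ × ℤ))
              (fun _ : Fin m => (0, 1)) v).2 := by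
            rw [Prod.snd_sum]
            refine Finset.sum_nonneg fun v _ => ?_
            refine Fin.addCases (fun i => ?_) (fun i => ?_) v <;> simp
          simp only [Prod.snd_sub, Prod.snd_add, Prod.smul_snd, smul_zero, add_zero]
          omega
        · exact hT.2 hTA
      exact ⟨0, fun T => zero_mem _, by rw [map_zero, this]⟩
    have step : ∀ b : ℤ, KoszulExactOn
        (Fin.append (fun i : Fin n => (X (Sum.inl i) : BiPoly K n m))
          (fun j : Fin m => X (Sum.inr j)))
        (Fin.append (fun _ : Fin n => ((1, 0) : ℤ × ℤ)) (fun _ : Fin m => (0, 1)))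
        (quotPart J) (1, 0) ((insert y Y).map (Fin.natAddEmb n))ᶜ (a, b - 1) → KoszulExactOn
        (Fin.append (fun i : Fin n => (X (Sum.inl i) : BiPoly K n m))
          (fun j : Fin m => X (Sum.inr j)))
        (Fin.append (fun _ : Fin n => ((1, 0) : ℤ × ℤ)) (fun _ : Fin m => (0, 1)))
        (quotPart J) (1, 0) ((insert y Y).map (Fin.natAddEmb n))ᶜ (a, b) := by
      intro b hb
      refine KoszulExactOn.of_insert hmem (fun δ x hx => ?_) (ih b) (by simpa using hb)
      rw [Fin.append_right, Fin.append_right]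
      exact mul_mem_quotPart (isWeightedHomogeneous_X K (biWeight n m) (Sum.inr y)) hx
    rcases lt_or_ge b 0 with hb | hb
    · exact hneg b hb
    · obtain ⟨k, rfl⟩ := Int.eq_ofNat_of_zero_le hb
      clear hb
      induction k with
      | zero => exact step _ (hneg _ (by simp))
      | succ k ihk => exact step _ (by simpa using ihk)

/-- Vanishing of bigraded Betti numbers along a strand makes the Koszul complex of
`x_1, …, x_n` exact along that strand in every `y`-degree. -/
theorem strandExactMod_of_biBetti_eq_zero {J : Ideal (BiPoly K n m)} {a : ℤ}
    (h : ∀ (i : ℕ) (b : ℤ), biBetti J i (a + i, b) = 0) (j : ℤ) : StrandExactMod J j a := by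
  have h1 := koszulExactOn_compl_map h Finset.univ j
  have hcompl : ((Finset.univ : Finset (Fin m)).map (Fin.natAddEmb n))ᶜ =
      (Finset.univ : Finset (Fin n)).map (Fin.castAddEmb m) := by
    ext v
    refine Fin.addCases (fun i => ?_) (fun i => ?_) v
    · simp [Fin.ext_iff]; intro x; omega
    · simp [Fin.ext_iff]; intro x; omega
  rw [hcompl] at h1
  have h2 := h1.castAdd fun i => Fin.append_left _ _ i
  simp only [Fin.append_left, Prod.mk_sub_mk, sub_zero] at h2
  rw [koszulExact_iff_of_image_eq (R := BiPoly K n m) (R'' := BiPoly K n m)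
    (Ideal.Quotient.mk J : BiPoly K n m →+ BiPoly K n m ⧸ J)
    (AddMonoidHom.id _) Function.injective_id
    (r := fun v : Fin n => (X (Sum.inl v) : BiPoly K n m))
    (s := fun v : Fin n => (X (Sum.inl v) : BiPoly K n m))
    (𝓐 := fun _ => biPart K n m (a, j)) (𝓑 := fun _ => biPart K n m (a - 1, j))
    (fun v x => rfl) (fun v x => rfl)
    (fun T => by simp [quotPart])
    (fun T => by simp [quotPart])] at h2
  intro z hz hzJ
  obtain ⟨w, hw, hwz⟩ := h2 z hz fun T => Ideal.Quotient.eq_zero_iff_mem.2 (hzJ T)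
  exact ⟨w, hw, fun T => Ideal.Quotient.eq_zero_iff_mem.1 (hwz T)⟩

end Elimination

/-! ### Regularity of the powers. -/

section Regularity

variable {K : Type*} [Field K] {n m : ℕ}

/-- For `f_l ≠ 0` the element `y_l^j` in exterior degree 0 is a cycle outside `J`, and chains
bounding it would have `x`-degree -1. -/
theorem not_strandExactMod_zero {f : Fin m → MvPolynomial (Fin n) K}
    (hI : Ideal.span (Set.range f) ≠ ⊥) (j : ℕ) : ¬ StrandExactMod (reesIdeal f) j 0 := by
  classical
  obtain ⟨l, hl⟩ : ∃ l, f l ≠ 0 := by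
    by_contra hcon
    push Not at hcon
    refine hI (Ideal.span_eq_bot.2 ?_)
    rintro _ ⟨l, rfl⟩
    exact hcon l
  have hq : (X (Sum.inr l) ^ j : BiPoly K n m) ∈ biPart K n m (0, j) := by
    have := (isWeightedHomogeneous_X K (biWeight n m) (Sum.inr l)).pow j
    simpa [biWeight] using this
  intro h
  obtain ⟨w, hw, hwz⟩ := h (Pi.single ∅ (X (Sum.inr l) ^ j)) (fun T => by
      by_cases hT : T = ∅
      · subst hT; simpa using hq
      · rw [Pi.single_eq_of_ne hT]; exact zero_mem _) (fun T => by
      rw [koszulDiff_apply_eq_zero fun v _ => Pi.single_eq_of_ne (Finset.insert_ne_empty v T) _]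
      exact zero_mem _)
  have hw0 : w = 0 := by
    funext T
    exact biPart_eq_zero (Or.inl (by simp)) (hw T)
  have := hwz ∅
  rw [hw0, map_zero, Pi.zero_apply, sub_zero, Pi.single_eq_same, mem_reesIdeal_iff hq] at this
  exact pow_ne_zero j hl (by simpa [reesEval] using this)

theorem mem_regSet_iff {d : ℕ} {f : Fin m → MvPolynomial (Fin n) K}
    (hf : ∀ j, (f j).IsHomogeneous d) (j : ℕ) (r : ℤ) :
    (∃ i : ℕ, koszulBetti (fun v : Fin n => (X v : MvPolynomial (Fin n) K)) (fun _ => (1 : ℤ))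
      (idealPart (Ideal.span (Set.range f) ^ j)) i (i + r) ≠ 0) ↔
      ¬ StrandExactMod (reesIdeal f) j (r - j * d) := by
  rw [← forall_koszulBetti_pow_eq_zero_iff hf, sub_add_cancel]
  push Not
  rfl

theorem regIdeal_pow_le {d : ℕ} {f : Fin m → MvPolynomial (Fin n) K}
    (hf : ∀ j, (f j).IsHomogeneous d) (j : ℕ) :
    regIdeal (Ideal.span (Set.range f) ^ j) ≤ ((j * d : ℕ) : EReal) + regX (reesIdeal f) := by
  refine sSup_le ?_
  rintro _ ⟨r, hr, rfl⟩
  have h1 := (mem_regSet_iff hf j r).1 hr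
  have h2 : ∃ (i : ℕ) (b : ℤ), biBetti (reesIdeal f) i ((r - j * d) + i, b) ≠ 0 := by
    by_contra hcon
    push Not at hcon
    exact h1 (strandExactMod_of_biBetti_eq_zero hcon j)
  have h3 : (((r - j * d : ℤ) : ℝ) : EReal) ≤ regX (reesIdeal f) := le_sSup ⟨_, h2, rfl⟩
  have h4 : ((r : ℝ) : EReal) = ((j * d : ℕ) : EReal) + (((r - j * d : ℤ) : ℝ) : EReal) := by
    rw [← EReal.coe_natCast, ← EReal.coe_add]
    congr 1
    push_cast; ring
  simp only
  rw [h4]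
  exact add_le_add_right h3 _

theorem regIdeal_pow_eq {d : ℕ} {f : Fin m → MvPolynomial (Fin n) K}
    (hf : ∀ j, (f j).IsHomogeneous d) {j c : ℕ}
    (hc : ¬ StrandExactMod (reesIdeal f) j c)
    (hc' : ∀ a > (c : ℤ), StrandExactMod (reesIdeal f) j a) :
    regIdeal (Ideal.span (Set.range f) ^ j) = ((j * d + c : ℕ) : EReal) := by
  have hcast : ((j * d + c : ℕ) : EReal) = (((j * d + c : ℤ) : ℝ) : EReal) := by
    rw [← EReal.coe_natCast]; congr 1
  rw [hcast]
  refine le_antisymm (sSup_le ?_) (le_sSup ⟨_, (mem_regSet_iff hf j _).2 (by simpa using hc), rfl⟩)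
  rintro _ ⟨r, hr, rfl⟩
  have h1 := (mem_regSet_iff hf j r).1 hr
  have h2 : r - j * d ≤ c := by
    by_contra hcon
    exact h1 (hc' _ (by omega))
  simp only [EReal.coe_le_coe_iff, Int.cast_le]
  omega

/-- By Dickson's lemma the supremum in `mY` is over a finite set, so it is a true upper bound and
not the default value for unbounded sets. -/
theorem yDeg_le_mY {B : Ideal (BiPoly K n m)} {A : Set (Fin n ⊕ Fin m →₀ ℕ)}
    (h : ∀ s, monomial s (1 : K) ∈ B ↔ s ∈ A) {t : Fin n ⊕ Fin m →₀ ℕ} (ht : t ∈ minExps A) :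
    yDeg t ≤ mY B := by
  have hmin : minGens B = minExps A := by
    ext s; simp only [minGens, minExps, h]
  rw [mY, hmin]
  exact le_csSup ((finite_minExps A).image _).bddAbove ⟨t, ht, rfl⟩

/-- The regularity of the powers of `I` is linear from the maximal `y`-degree of the generators of
the bigeneric initial ideal on. -/
theorem exists_forall_regIdeal_pow_eq [Infinite K] [CharZero K] {d : ℕ}
    {f : Fin m → MvPolynomial (Fin n) K} (hf : ∀ j, (f j).IsHomogeneous d)
    (hI : Ideal.span (Set.range f) ≠ ⊥) :
    ∃ c : ℕ, ∀ j : ℕ, mY (bigin (reesIdeal f)) ≤ j →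
      regIdeal (Ideal.span (Set.range f) ^ j) = ((j * d + c : ℕ) : EReal) := by
  classical
  have hm : 0 < m := by
    by_contra hm
    obtain rfl : m = 0 := by omega
    exact hI (by rw [Set.range_eq_empty, Ideal.span_empty])
  obtain ⟨g, hg, hgen⟩ := exists_initialIdeal_eq_bigin (reesIdeal f)
  set B := leadSet ((reesIdeal f).map (biAct g)) with hB
  set μ := mY (bigin (reesIdeal f)) with hμ
  have hupper : IsUpperSet B := isUpperSet_leadSet _
  have hstable : IsBistable B := fun a b hab s hs hsa => by
    rw [hgen] at hs ⊢
    exact exchange_mem_leadSet_map_genAct hab hs hsa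
  have hyDeg : ∀ t ∈ minExps B, yDeg t ≤ μ := fun t ht =>
    yDeg_le_mY (fun s => by rw [← hg, monomial_mem_initialIdeal_iff]) ht
  obtain ⟨D, hD⟩ := ((finite_minExps B).image xDeg).bddAbove
  have hgap : ∀ {k : Fin n} {j a : ℤ}, HasGap B k j a → a < D :=
    fun h => h.lt_of_bound hupper hstable fun t ht => hD ⟨t, ht, rfl⟩
  have hiff : ∀ j : ℕ, μ ≤ j → ∀ r : ℕ, (∀ a > (r : ℤ), StrandExactMod (reesIdeal f) j a) ↔
      ∀ a > (r : ℤ), ∀ k, ¬ HasGap B k μ a := by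
    intro j hj r
    rw [forall_strandExactMod_iff_hasGap (isBihomogeneous_reesIdeal hf) g
      (fun k a h => hgap h) (Int.natCast_nonneg r)]
    simp only [← hB, hasGap_iff hupper hstable hyDeg hm hj]
  -- The constant is the least `r ≥ 0` without gaps of `x`-degree above `r` in `y`-degree `μ`.
  have hex : ∃ r : ℕ, ∀ a > (r : ℤ), ∀ k, ¬ HasGap B k μ a :=
    ⟨D, fun a ha k h => by have := hgap h; omega⟩
  refine ⟨Nat.find hex, fun j hj => ?_⟩
  have hfind := (hiff j hj _).2 (Nat.find_spec hex)
  refine regIdeal_pow_eq hf ?_ hfind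
  -- By minimality some strand above `c - 1` is not exact, and it can only be `c`. For `c = 0`
  -- minimality says nothing, but strand 0 is never exact.
  rcases Nat.eq_zero_or_pos (Nat.find hex) with h0 | hpos
  · rw [h0]; exact not_strandExactMod_zero hI j
  · have hlt := Nat.find_min hex (Nat.sub_lt hpos one_pos)
    rw [← hiff j hj] at hlt
    push Not at hlt
    obtain ⟨a, ha, hna⟩ := hlt
    have : a = (Nat.find hex : ℤ) := by
      by_contra hne
      exact hna (hfind a (by omega))
    rwa [this] at hna

end Regularity

theorem theorem5p3 {K : Type*} [Field K] [Infinite K] {n m : ℕ} (d : ℕ)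
    (f : Fin m → MvPolynomial (Fin n) K) (hf : ∀ j, (f j).IsHomogeneous d) :
    (∀ j : ℕ, regIdeal (Ideal.span (Set.range f) ^ j) ≤
      ((j * d : ℕ) : EReal) + regX (reesIdeal f)) ∧
    (CharZero K → Ideal.span (Set.range f) ≠ ⊥ →
      ∃ c : ℕ, (c : EReal) ≤ regX (reesIdeal f) ∧
        ∀ j : ℕ, mY (bigin (reesIdeal f)) ≤ j →
          regIdeal (Ideal.span (Set.range f) ^ j) = ((j * d + c : ℕ) : EReal)) := by
  refine ⟨regIdeal_pow_le hf, fun _ hI => ?_⟩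
  obtain ⟨c, hc⟩ := exists_forall_regIdeal_pow_eq hf hI
  refine ⟨c, ?_, hc⟩
  -- Comparing (i) with the formula at the single exponent `j = m_y` bounds `c`; cancelling `jd`
  -- requires `reg_x` finite, and `⊥` is impossible because the left side is a real number.
  have h := regIdeal_pow_le hf (mY (bigin (reesIdeal f)))
  rw [hc _ le_rfl] at h
  induction hx : regX (reesIdeal f) with
  | bot =>
    rw [hx, EReal.add_bot] at h
    exact absurd h (not_le.2 (by rw [← EReal.coe_natCast]; exact EReal.bot_lt_coe _))
  | top => exact le_top
  | coe x =>
    rw [hx, ← EReal.coe_natCast, ← EReal.coe_natCast, ← EReal.coe_add, EReal.coe_le_coe_iff] at h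
    rw [← EReal.coe_natCast, EReal.coe_le_coe_iff]
    push_cast at h
    linarith
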